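/- Let $d\ge 1$ be an integer and let $V=(V_j(t))_{j\in\mathbb Z^d}$, $t\in[0,1]$, be a bounded complex-valued time-dependent potential, i.e. $\sup_{j\in\mathbb Z^d,\ t\in[0,1]}|V_j(t)|<\infty$. For $v=(v_j)_{j\in\mathbb Z^d}$ put $$\Delta_d v_j=\sum_{k=1}^d\,(v_{j+e_k}-2v_j+v_{j-e_k}),$$ where $e_1,\dots,e_d$ are the coordinate vectors. Let $u\in C([0,1];\ell^2(\mathbb Z^d;\mathbb C))$ be a solution of the perturbed discrete Schrödinger equation $$\partial_t u_j=i(\Delta_d u_j+V_ju_j),\qquad j\in\mathbb Z^d,\ t\in[0,1],$$ in the sense that for every $j\in\mathbb Z^d$ the function $t\mapsto u_j(t)$ is absolutely continuous on $[0,1]$ and satisfies the equation for almost every $t\in(0,1)$ (in particular, every classical solution in $C([0,1];\ell^2(\mathbb Z^d;\mathbb C))$ qualifies). If, for some real number $\lambda>\frac12$, $$\sum_{j\in\mathbb Z^d}e^{2\lambda|j|^2}\big(|u_j(0)|^2+|u_j(1)|^2\big)<\infty,\qquad |j|^2=j_1^2+\dots+j_d^2,$$ then $u\equiv 0$, i.e.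 $u_j(t)=0$ for all $j\in\mathbb Z^d$ and all $t\in[0,1]$. -/

import Mathlib

open MeasureTheory Set

/-- The `d`-dimensional lattice `ℤ^d`. -/
abbrev IntLattice (d : ℕ) : Type := Fin d → ℤ

/-- The Hilbert space `ℓ²(ℤ^d)` of complex square-summable sequences. -/
abbrev EllTwo (d : ℕ) : Type := lp (fun _ : IntLattice d => ℂ) 2

/-- The squared Euclidean norm `|j|² = j₁² + ⋯ + j_d²` of a lattice point. -/
def normSqLattice {d : ℕ} (j : IntLattice d) : ℝ := ∑ k : Fin d, (j k : ℝ) ^ 2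

/-- The discrete Laplacian
`(Δ_d v)_j = ∑_k (v_{j+e_k} - 2 v_j + v_{j-e_k})`; here `Pi.single k 1` is the `k`-th
coordinate vector `e_k`. -/
def discreteLaplacian {d : ℕ} (v : IntLattice d → ℂ) (j : IntLattice d) : ℂ :=
  ∑ k : Fin d, (v (j + Pi.single k 1) - 2 * v j + v (j - Pi.single k 1))

/-- `V = (V_j(t))` is a bounded complex potential:
`sup {|V_j(t)| : j ∈ ℤ^d, t ∈ [0,1]} < ∞`. -/
def IsBoundedPotential {d : ℕ} (V : IntLattice d → ℝ → ℂ) : Prop :=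
  ∃ C : ℝ, ∀ j : IntLattice d, ∀ t ∈ Icc (0 : ℝ) 1, ‖V j t‖ ≤ C

/-- `u` is a solution in `C([0,1]; ℓ²(ℤ^d))` of
`∂_t u_j = i (Δ_d u_j + V_j u_j)` on `[0,1]`.
As `V` need not be continuous in time, the equation holds in the Carathéodory sense: every
coordinate `u_j` is absolutely continuous and satisfies the equation at almost every time.
In particular every classical solution in `C([0,1]; ℓ²(ℤ^d))` with bounded `V` is one. -/
structure IsSchrodingerSolution {d : ℕ} (V : IntLattice d → ℝ → ℂ) (u : ℝ → EllTwo d) : Prop where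
  continuousOn : ContinuousOn u (Icc 0 1)
  absolutelyContinuous : ∀ j : IntLattice d,
    AbsolutelyContinuousOnInterval (fun t => u t j) 0 1
  equation : ∀ j : IntLattice d, ∀ᵐ t : ℝ, t ∈ Ioo (0 : ℝ) 1 →
    HasDerivAt (fun s => u s j)
      (Complex.I * (discreteLaplacian (u t) j + V j t * u t j)) t

/-! ### Absolutely continuous functions -/

/-! The proof is a Carleman-type argument in a single coordinate direction `k`. Multiply `u` by `exp
(g (j k) - B / 2 * t * (1 - t))`. The product `v` satisfies `∂ₜ v = S v + A v + F`. Here `S` is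
symmetric and `A` antisymmetric; both come from the hopping along `k`, and `S` also carries the
logarithmic time derivative of the weight. The rest `F` collects the hopping in the other directions
(which the weight does not see), the diagonal and the potential. It is bounded in `ℓ²` by `M * ‖v‖`,
with `M` independent of `g` and `B`.

Let `D = ⟨S v, v⟩`. Completing a square in `dD/dt` shows that `D` is nondecreasing as soon as `B`
plus a diagonal lower bound for the commutator of `S` and `A` is at least `M ^ 2 / 2`
(`tsum_energy_deriv_nonneg`). On the other hand `d‖v‖²/dt` differs from `2 * D` by at most `2 * M *
‖v‖²`. Since `D` changes sign at most once, `‖v(t)‖²` is at most `exp (2 * M)` times the sum of its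
two endpoint values (`IsConjugatedSolution.tsum_norm_sq_le`), and these do not involve `B`.

Take `g n = β * |n| + n ^ 2 / 2`. Because hopping produces hyperbolic sines of the increments, the
commutator is at least `exp (2 * β) - 4` at every site (`exp_sub_four_le_commutatorWeight`), so `B`
may be as negative as `-exp (2 * β)` up to a constant. The endpoint sums cost only `exp (β ^ 2 / (2
* λ - 1))`, which is where `λ > 1/2` enters, while at an interior time the weight gains `exp (t * (1
- t) * exp (2 * β))`. Letting `β → ∞` forces `u t j = 0` (`eq_zero_of_mem_Ioo`), and continuity
covers the endpoints.

To differentiate the sums, the conjugated solution must decay at all times. Exponential decay of any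
rate propagates from time `0` (`norm_le_of_initial_decay`). Linear weights, whose commutator
vanishes, then yield Gaussian decay of rate `λ` in the coordinate `k` (`exists_gaussian_decay`).
Together the two control the peaked weight (`exists_peaked_decay`). -/

theorem AbsolutelyContinuousOnInterval.clm_comp {E F : Type*} [NormedAddCommGroup E]
    [NormedSpace ℝ E] [NormedAddCommGroup F] [NormedSpace ℝ F] (L : E →L[ℝ] F) {f : ℝ → E}
    {a b : ℝ} (hf : AbsolutelyContinuousOnInterval f a b) :
    AbsolutelyContinuousOnInterval (fun t => L (f t)) a b := by
  apply squeeze_zero (fun t ↦ ?_) (fun t ↦ ?_)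
    (by simpa using Filter.Tendsto.const_mul ‖L‖ hf)
  · exact Finset.sum_nonneg (fun i hi ↦ dist_nonneg)
  · simp only [Finset.mul_sum]
    gcongr with i hi
    simp only [dist_eq_norm, ← map_sub]
    exact L.le_opNorm _

theorem AbsolutelyContinuousOnInterval.le_of_ae_deriv_nonneg {f f' : ℝ → ℝ} {s t : ℝ}
    (hst : s ≤ t) (hf : AbsolutelyContinuousOnInterval f s t)
    (hf' : ∀ᵐ x, x ∈ Ioo s t → HasDerivAt f (f' x) x ∧ 0 ≤ f' x) : f s ≤ f t := by
  rw [← sub_nonneg, ← hf.integral_deriv_eq_sub, intervalIntegral.integral_of_le hst,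
    ← restrict_Ioo_eq_restrict_Ioc]
  apply integral_nonneg_of_ae
  rw [Filter.EventuallyLE, ae_restrict_iff' measurableSet_Ioo]
  filter_upwards [hf'] with x hx hxs
  rw [(hx hxs).1.deriv]
  exact (hx hxs).2

/-- Projecting `f` onto the direction of its total increment reduces this mean value inequality to
monotonicity of a real function. -/
theorem AbsolutelyContinuousOnInterval.norm_sub_le {f f' : ℝ → ℂ} {φ φ' : ℝ → ℝ} {s t : ℝ}
    (hst : s ≤ t) (hf : AbsolutelyContinuousOnInterval f s t)
    (hφ : AbsolutelyContinuousOnInterval φ s t) (hφ' : ∀ x ∈ Ioo s t, HasDerivAt φ (φ' x) x)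
    (hf' : ∀ᵐ x, x ∈ Ioo s t → HasDerivAt f (f' x) x ∧ ‖f' x‖ ≤ φ' x) :
    ‖f t - f s‖ ≤ φ t - φ s := by
  set z := f t - f s with hz
  by_cases hz0 : z = 0
  · rw [hz0, norm_zero, sub_nonneg]
    refine hφ.le_of_ae_deriv_nonneg (f' := φ') hst ?_
    filter_upwards [hf'] with x hx hxs
    exact ⟨hφ' x hxs, (norm_nonneg _).trans (hx hxs).2⟩
  let L : ℂ →L[ℝ] ℝ := Complex.reCLM.comp
    ((ContinuousLinearMap.mul ℂ ℂ ((starRingEnd ℂ) z / ‖z‖)).restrictScalars ℝ)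
  have hL : ∀ w, L w = ((starRingEnd ℂ) z / ‖z‖ * w).re := fun w => rfl
  have hLn : ∀ w, L w ≤ ‖w‖ := by
    intro w
    rw [hL]
    refine (Complex.re_le_norm _).trans ?_
    rw [norm_mul, norm_div, RCLike.norm_conj, Complex.norm_real, norm_norm,
      div_self (norm_ne_zero_iff.2 hz0), one_mul]
  have hLz : L z = ‖z‖ := by
    rw [hL, div_mul_eq_mul_div, mul_comm, Complex.mul_conj, Complex.normSq_eq_norm_sq,
      ← Complex.ofReal_div, Complex.ofReal_re, pow_two, mul_div_assoc,
      div_self (norm_ne_zero_iff.2 hz0), mul_one]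
  have key := (hφ.sub (hf.clm_comp L)).le_of_ae_deriv_nonneg
    (f' := fun x => φ' x - L (f' x)) hst (by
      filter_upwards [hf'] with x hx hxs
      refine ⟨(hφ' x hxs).sub (L.hasFDerivAt.comp_hasDerivAt x (hx hxs).1), ?_⟩
      linarith [hLn (f' x), (hx hxs).2])
  simp only [Pi.sub_apply] at key
  have h2 : L z = L (f t) - L (f s) := by rw [hz, map_sub]
  linarith

/-- Only the sum of the derivatives has a sign, not the individual terms; the domination by `B`
allows sum and integral to be exchanged. -/
theorem tsum_le_tsum_of_ae_deriv_nonneg {ι : Type*} [Countable ι] {f f' : ι → ℝ → ℝ}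
    {B : ι → ℝ} {s t : ℝ} (hst : s ≤ t)
    (hf : ∀ i, AbsolutelyContinuousOnInterval (f i) s t) (hB : Summable B)
    (hf' : ∀ᵐ x, x ∈ Ioo s t → (∀ i, HasDerivAt (f i) (f' i x) x ∧ |f' i x| ≤ B i) ∧
      0 ≤ ∑' i, f' i x)
    (hs : Summable fun i => f i s) (ht : Summable fun i => f i t) :
    ∑' i, f i s ≤ ∑' i, f i t := by
  set μ : Measure ℝ := volume.restrict (Ioc s t) with hμ
  have hae : ∀ᵐ x ∂μ, (∀ i, HasDerivAt (f i) (f' i x) x ∧ |f' i x| ≤ B i) ∧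
      0 ≤ ∑' i, f' i x := by
    rw [hμ, ← restrict_Ioo_eq_restrict_Ioc, ae_restrict_iff' measurableSet_Ioo]
    exact hf'
  have hint : ∀ i, Integrable (deriv (f i)) μ := fun i => by
    have := (hf i).intervalIntegrable_deriv
    rwa [intervalIntegrable_iff_integrableOn_Ioc_of_le hst] at this
  have hsum : Summable fun i => ∫ x, ‖deriv (f i) x‖ ∂μ := by
    refine Summable.of_nonneg_of_le (fun i => integral_nonneg fun _ => norm_nonneg _)
      (fun i => ?_) (hB.mul_left (t - s))
    have : ∫ x, ‖deriv (f i) x‖ ∂μ ≤ ∫ _, B i ∂μ := by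
      refine integral_mono_ae (hint i).norm (integrable_const _) ?_
      filter_upwards [hae] with x hx
      rw [(hx.1 i).1.deriv]
      exact (hx.1 i).2
    refine this.trans_eq ?_
    simp [hμ, measureReal_def, sub_nonneg.2 hst]
  have h1 := hasSum_integral_of_summable_integral_norm hint hsum
  have h2 : ∀ i, ∫ x, deriv (f i) x ∂μ = f i t - f i s := fun i => by
    rw [← (hf i).integral_deriv_eq_sub, intervalIntegral.integral_of_le hst]
  simp only [h2] at h1
  rw [← sub_nonneg, ← ht.tsum_sub hs, h1.tsum_eq]
  apply integral_nonneg_of_ae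
  filter_upwards [hae] with x hx
  have : ∀ i, deriv (f i) x = f' i x := fun i => (hx.1 i).1.deriv
  change 0 ≤ ∑' i, deriv (f i) x
  simpa only [this] using hx.2

/-! ### The commutator estimate -/

theorem tsum_comp_sub_self {ι : Type*} (σ : Equiv.Perm ι) {Y : ι → ℝ} (hY : Summable Y) :
    ∑' j, (Y (σ j) - Y j) = 0 := by
  have h : Summable fun j => Y (σ j) := σ.summable_iff.2 hY
  rw [h.tsum_sub hY, σ.tsum_eq Y, sub_self]

/-- Pointwise form of the commutator estimate: `vm, v, vp` are the values at three consecutive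
sites, `x` and `y` the increments of the weight along the two edges, `w` the time derivative at the
middle site. -/
theorem commutator_pointwise (vm v vp F w : ℂ) (x y c c2 : ℝ)
    (hw : w = c * v + Complex.I * (Real.exp (-y) * vp + Real.exp x * vm) + F) :
    - (‖F‖ ^ 2 / 2) - |Real.sinh (y - x)| * (‖vp‖ ^ 2 + ‖vm‖ ^ 2)
      + Real.sinh (2 * x) * ‖vm‖ ^ 2 - Real.sinh (2 * y) * ‖vp‖ ^ 2 + c2 * ‖v‖ ^ 2
      + 2 * c * (Real.cosh x * ((starRingEnd ℂ) vm * v).im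
        - Real.cosh y * ((starRingEnd ℂ) v * vp).im)
    ≤ 2 * Real.sinh y * ((starRingEnd ℂ) w * vp).im
      + 2 * Real.sinh x * ((starRingEnd ℂ) vm * w).im
      + c2 * ‖v‖ ^ 2 + 2 * c * ((starRingEnd ℂ) v * w).re := by
  have h1 : Real.exp (-y) = Real.cosh y - Real.sinh y := by
    rw [Real.cosh_sub_sinh]
  have h2 : Real.exp x = Real.cosh x + Real.sinh x := (Real.cosh_add_sinh x).symm
  rw [h1, h2] at hw
  rw [Real.sinh_sub, Real.sinh_two_mul, Real.sinh_two_mul]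
  generalize Real.cosh x = cx at *
  generalize Real.cosh y = cy at *
  generalize Real.sinh x = sx at *
  generalize Real.sinh y = sy at *
  subst hw
  obtain ⟨a, b⟩ := vm
  obtain ⟨p, q⟩ := v
  obtain ⟨r, s⟩ := vp
  obtain ⟨f, g⟩ := F
  simp only [← Complex.normSq_eq_norm_sq, Complex.normSq_apply, Complex.mul_re, Complex.mul_im,
    Complex.conj_re, Complex.conj_im, Complex.add_re, Complex.add_im, Complex.ofReal_re,
    Complex.ofReal_im, Complex.I_re, Complex.I_im]
  set δ := sy * cx - cy * sx with hδ
  have hcross : -(|δ| * (r * r + s * s + (a * a + b * b))) ≤ -(2 * δ * (r * a + s * b)) := by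
    have h3 : 2 * δ * (r * a + s * b) ≤ |δ| * |2 * (r * a + s * b)| := by
      rw [← abs_mul]; refine le_trans (le_of_eq ?_) (le_abs_self _); ring
    have h4 : |2 * (r * a + s * b)| ≤ r * r + s * s + (a * a + b * b) := by
      rw [abs_le]; constructor <;> nlinarith [sq_nonneg (r - a), sq_nonneg (s - b),
        sq_nonneg (r + a), sq_nonneg (s + b)]
    nlinarith [abs_nonneg δ]
  -- This is `‖S v + F / 2‖ ^ 2 ≥ 0` at one site, with `S` the symmetric part. It yields `2 * Re ⟨S
  -- v, S v + F⟩ ≥ -‖F‖ ^ 2 / 2`.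
  have hsq := add_nonneg (sq_nonneg (sy * s - sx * b + c * p + f / 2))
    (sq_nonneg (-sy * r + sx * a + c * q + g / 2))
  rw [hδ] at hcross
  rw [hδ]
  nlinarith [hcross, hsq]

theorem Real.abs_sinh_le_exp_abs (x : ℝ) : |Real.sinh x| ≤ Real.exp |x| := by
  rw [Real.abs_sinh, Real.sinh_eq]
  linarith [Real.exp_pos (-|x|), Real.exp_pos |x|]

theorem Real.cosh_le_exp_abs (x : ℝ) : Real.cosh x ≤ Real.exp |x| := by
  rw [← Real.cosh_abs, Real.cosh_eq]
  linarith [Real.exp_le_exp.2 (by linarith [abs_nonneg x] : -|x| ≤ |x|)]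

theorem Real.exp_abs_le_exp_two_mul_abs (x : ℝ) : Real.exp |x| ≤ Real.exp (2 * |x|) :=
  Real.exp_le_exp.2 (by linarith [abs_nonneg x])

theorem Real.abs_sinh_sub_le {x y r : ℝ} (hx : Real.exp (2 * |x|) ≤ r)
    (hy : Real.exp (2 * |y|) ≤ r) : |Real.sinh (x - y)| ≤ r := by
  refine (Real.abs_sinh_le_exp_abs _).trans ?_
  rcases le_total |x| |y| with h | h
  · exact (Real.exp_le_exp.2 (by linarith [abs_sub x y])).trans hy
  · exact (Real.exp_le_exp.2 (by linarith [abs_sub x y])).trans hx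

theorem Complex.abs_im_conj_mul_le {z w : ℂ} {a b : ℝ} (hz : ‖z‖ ≤ a) (hw : ‖w‖ ≤ b) :
    |((starRingEnd ℂ) z * w).im| ≤ a * b := by
  refine (Complex.abs_im_le_norm _).trans ?_
  rw [norm_mul, RCLike.norm_conj]
  exact mul_le_mul hz hw (norm_nonneg _) ((norm_nonneg _).trans hz)

theorem Complex.abs_re_conj_mul_le {z w : ℂ} {a b : ℝ} (hz : ‖z‖ ≤ a) (hw : ‖w‖ ≤ b) :
    |((starRingEnd ℂ) z * w).re| ≤ a * b := by
  refine (Complex.abs_re_le_norm _).trans ?_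
  rw [norm_mul, RCLike.norm_conj]
  exact mul_le_mul hz hw (norm_nonneg _) ((norm_nonneg _).trans hz)

/-- Domination hypotheses for the commutator estimate along the orbits of `σ`: `θ` are the
increments of the weight along the edges `j ⟶ σ j`, `m` dominates the sequences involved. -/
structure EdgeDominated {ι : Type*} (σ : Equiv.Perm ι) (θ m r : ι → ℝ) : Prop where
  nonneg : ∀ j, 0 ≤ m j
  self : ∀ j, Real.exp (2 * |θ j|) ≤ r j
  next : ∀ j, Real.exp (2 * |θ (σ j)|) ≤ r j
  prev : ∀ j, Real.exp (2 * |θ (σ.symm j)|) ≤ r j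
  prevprev : ∀ j, Real.exp (2 * |θ (σ.symm (σ.symm j))|) ≤ r j
  summable : Summable fun j => r j * m j ^ 2

namespace EdgeDominated

variable {ι : Type*} {σ : Equiv.Perm ι} {θ m r : ι → ℝ}

theorem one_le (h : EdgeDominated σ θ m r) (j : ι) : 1 ≤ r j :=
  (Real.one_le_exp (by positivity)).trans (h.self j)

theorem sq_le (h : EdgeDominated σ θ m r) (j : ι) : m j ^ 2 ≤ r j * m j ^ 2 :=
  le_mul_of_one_le_left (sq_nonneg _) (h.one_le j)

theorem exp_mul_le (h : EdgeDominated σ θ m r) (j : ι) :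
    Real.exp |θ j| * (m j * m (σ j)) ≤ r j * m j ^ 2 + r (σ j) * m (σ j) ^ 2 := by
  have h1 := (Real.exp_abs_le_exp_two_mul_abs (θ j)).trans (h.self j)
  have h2 := (Real.exp_abs_le_exp_two_mul_abs (θ j)).trans
    (by simpa using h.prev (σ j) : Real.exp (2 * |θ j|) ≤ r (σ j))
  have h3 : m j * m (σ j) ≤ m j ^ 2 + m (σ j) ^ 2 := by
    nlinarith [sq_nonneg (m j - m (σ j)), sq_nonneg (m j), sq_nonneg (m (σ j))]
  calc _ ≤ Real.exp |θ j| * (m j ^ 2 + m (σ j) ^ 2) := by gcongr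
    _ = Real.exp |θ j| * m j ^ 2 + Real.exp |θ j| * m (σ j) ^ 2 := by ring
    _ ≤ _ := by gcongr

theorem summable_next (h : EdgeDominated σ θ m r) :
    Summable fun j => r j * m j ^ 2 + r (σ j) * m (σ j) ^ 2 :=
  h.summable.add (σ.summable_iff.2 h.summable)

theorem summable_norm_sq (h : EdgeDominated σ θ m r) {v : ι → ℂ} (hv : ∀ j, ‖v j‖ ≤ m j) :
    Summable fun j => ‖v j‖ ^ 2 :=
  Summable.of_nonneg_of_le (fun _ => by positivity)
    (fun j => (pow_le_pow_left₀ (norm_nonneg _) (hv j) 2).trans (h.sq_le j)) h.summable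

/-- The current of a sequence along an edge, weighted by a factor at most `exp |θ j|`. -/
theorem abs_current_le (h : EdgeDominated σ θ m r) {v w : ι → ℂ} {k : ι → ℝ}
    (hk : ∀ j, |k j| ≤ Real.exp |θ j|) (hv : ∀ j, ‖v j‖ ≤ m j) (hw : ∀ j, ‖w j‖ ≤ m j) (j : ι) :
    |k j * ((starRingEnd ℂ) (v j) * w (σ j)).im| ≤ r j * m j ^ 2 + r (σ j) * m (σ j) ^ 2 := by
  rw [abs_mul]
  refine le_trans ?_ (h.exp_mul_le j)
  gcongr
  · exact hk j
  · exact Complex.abs_im_conj_mul_le (hv j) (hw _)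

theorem summable_current (h : EdgeDominated σ θ m r) {v w : ι → ℂ} {k : ι → ℝ}
    (hk : ∀ j, |k j| ≤ Real.exp |θ j|) (hv : ∀ j, ‖v j‖ ≤ m j) (hw : ∀ j, ‖w j‖ ≤ m j) :
    Summable fun j => k j * ((starRingEnd ℂ) (v j) * w (σ j)).im :=
  Summable.of_norm_bounded h.summable_next fun j => h.abs_current_le hk hv hw j

theorem summable_mul_norm_sq (h : EdgeDominated σ θ m r) {v : ι → ℂ} {k : ι → ℝ}
    (hk : ∀ j, |k j| ≤ r j) (hv : ∀ j, ‖v j‖ ≤ m j) :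
    Summable fun j => k j * ‖v j‖ ^ 2 := by
  refine Summable.of_norm_bounded h.summable fun j => ?_
  rw [norm_mul, Real.norm_eq_abs, norm_pow, norm_norm]
  exact mul_le_mul (hk j) (pow_le_pow_left₀ (norm_nonneg _) (hv j) 2) (by positivity)
    ((abs_nonneg _).trans (hk j))

theorem abs_re_le (h : EdgeDominated σ θ m r) {v w : ι → ℂ} (hv : ∀ j, ‖v j‖ ≤ m j)
    (hw : ∀ j, ‖w j‖ ≤ m j) (j : ι) :
    |((starRingEnd ℂ) (v j) * w j).re| ≤ r j * m j ^ 2 := by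
  refine (Complex.abs_re_conj_mul_le (hv j) (hw j)).trans ?_
  rw [← pow_two]; exact h.sq_le j

theorem summable_re (h : EdgeDominated σ θ m r) {v w : ι → ℂ} (hv : ∀ j, ‖v j‖ ≤ m j)
    (hw : ∀ j, ‖w j‖ ≤ m j) :
    Summable fun j => ((starRingEnd ℂ) (v j) * w j).re :=
  Summable.of_norm_bounded h.summable fun j => h.abs_re_le hv hw j

end EdgeDominated

/-- The diagonal coefficient bounding from below the commutator of the symmetric and antisymmetric
parts of the conjugated hopping operator. -/
noncomputable def commutatorWeight {ι : Type*} (σ : Equiv.Perm ι) (θ : ι → ℝ) (j : ι) : ℝ :=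
  Real.sinh (2 * θ j) - Real.sinh (2 * θ (σ.symm j)) - |Real.sinh (θ (σ j) - θ j)|
    - |Real.sinh (θ (σ.symm j) - θ (σ.symm (σ.symm j)))|

section

variable {ι : Type*} {σ : Equiv.Perm ι} {θ m r : ι → ℝ} {v w F : ι → ℂ} {c c2 M : ℝ}

/-- The sum is the time derivative of `⟨S v, v⟩`, with `c2` the time derivative of `c`. The
pointwise bound places its terms on neighbouring sites; moving them to the central site leaves
`commutatorWeight`, and `hq` absorbs the loss `‖F‖ ^ 2 / 2`. -/
theorem tsum_energy_deriv_nonneg (h : EdgeDominated σ θ m r)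
    (hv : ∀ j, ‖v j‖ ≤ m j) (hw : ∀ j, ‖w j‖ ≤ m j) (hF : ∀ j, ‖F j‖ ≤ m j)
    (heq : ∀ j, w j = c * v j + Complex.I * (Real.exp (-θ j) * v (σ j)
      + Real.exp (θ (σ.symm j)) * v (σ.symm j)) + F j)
    (hFM : ∑' j, ‖F j‖ ^ 2 ≤ M ^ 2 * ∑' j, ‖v j‖ ^ 2)
    (hq : ∀ j, M ^ 2 / 2 ≤ c2 + commutatorWeight σ θ j) :
    0 ≤ ∑' j, (2 * (Real.sinh (θ j) * (((starRingEnd ℂ) (w j) * v (σ j)).im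
      + ((starRingEnd ℂ) (v j) * w (σ j)).im))
      + (c2 * ‖v j‖ ^ 2 + 2 * c * ((starRingEnd ℂ) (v j) * w j).re)) := by
  have hsinh : ∀ j, |Real.sinh (θ j)| ≤ Real.exp |θ j| := fun j => Real.abs_sinh_le_exp_abs _
  have hcosh : ∀ j, |Real.cosh (θ j)| ≤ Real.exp |θ j| := fun j => by
    rw [abs_of_pos (Real.cosh_pos _)]; exact Real.cosh_le_exp_abs _
  have hs2 : ∀ x, |Real.sinh (2 * x)| ≤ Real.exp (2 * |x|) := fun x => by
    refine (Real.abs_sinh_le_exp_abs _).trans ?_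
    rw [abs_mul, abs_two]
  have s1 := h.summable_current hsinh hw hv
  have s2 := h.summable_current hsinh hv hw
  have s3 := h.summable_current hcosh hv hv
  have sv := h.summable_norm_sq hv
  have sF := h.summable_norm_sq hF
  have sre := h.summable_re hv hw
  have sA : Summable fun j => Real.sinh (2 * θ j) * ‖v j‖ ^ 2 :=
    h.summable_mul_norm_sq (fun j => (hs2 _).trans (h.self j)) hv
  have sB : Summable fun j => Real.sinh (2 * θ (σ.symm j)) * ‖v j‖ ^ 2 :=
    h.summable_mul_norm_sq (fun j => (hs2 _).trans (h.prev j)) hv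
  have sC : Summable fun j =>
      |Real.sinh (θ (σ.symm j) - θ (σ.symm (σ.symm j)))| * ‖v j‖ ^ 2 :=
    h.summable_mul_norm_sq (fun j => by
      rw [abs_abs]; exact Real.abs_sinh_sub_le (h.prev j) (h.prevprev j)) hv
  have sE : Summable fun j => |Real.sinh (θ (σ j) - θ j)| * ‖v j‖ ^ 2 :=
    h.summable_mul_norm_sq (fun j => by
      rw [abs_abs]; exact Real.abs_sinh_sub_le (h.next j) (h.self j)) hv
  -- `Y` collects everything that must be shifted by one site to turn the pointwise inequality into
  -- a diagonal one; its increments along `σ` sum to zero.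
  set Y : ι → ℝ := fun j =>
    2 * (Real.sinh (θ (σ.symm j)) * ((starRingEnd ℂ) (v (σ.symm j)) * w (σ (σ.symm j))).im)
    - 2 * c * (Real.cosh (θ (σ.symm j)) *
      ((starRingEnd ℂ) (v (σ.symm j)) * v (σ (σ.symm j))).im)
    - Real.sinh (2 * θ (σ.symm j)) * ‖v (σ.symm j)‖ ^ 2
    - Real.sinh (2 * θ (σ.symm j)) * ‖v j‖ ^ 2
    - |Real.sinh (θ (σ.symm j) - θ (σ.symm (σ.symm j)))| * ‖v j‖ ^ 2
    + |Real.sinh (θ (σ (σ.symm j)) - θ (σ.symm j))| * ‖v (σ.symm j)‖ ^ 2 with hY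
  have sY : Summable Y :=
    (((((σ.symm.summable_iff.2 s2).mul_left 2).sub
      ((σ.symm.summable_iff.2 s3).mul_left (2 * c))).sub (σ.symm.summable_iff.2 sA)).sub sB).sub
      sC |>.add (σ.symm.summable_iff.2 sE)
  have sYσ : Summable fun j => Y (σ j) - Y j := (σ.summable_iff.2 sY).sub sY
  have sq : Summable fun j => (c2 + commutatorWeight σ θ j) * ‖v j‖ ^ 2 := by
    refine ((((sv.mul_left c2).add sA).sub sB).sub sE |>.sub sC).congr fun j => ?_
    rw [commutatorWeight]; ring
  have hle : ∀ j, (c2 + commutatorWeight σ θ j) * ‖v j‖ ^ 2 - 1 / 2 * ‖F j‖ ^ 2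
      + (Y (σ j) - Y j) ≤ 2 * (Real.sinh (θ j) * (((starRingEnd ℂ) (w j) * v (σ j)).im
      + ((starRingEnd ℂ) (v j) * w (σ j)).im))
      + (c2 * ‖v j‖ ^ 2 + 2 * c * ((starRingEnd ℂ) (v j) * w j).re) := by
    intro j
    have key := commutator_pointwise (v (σ.symm j)) (v j) (v (σ j)) (F j) (w j)
      (θ (σ.symm j)) (θ j) c c2 (heq j)
    simp only [hY, commutatorWeight, Equiv.symm_apply_apply, Equiv.apply_symm_apply]
    linarith
  have stot : Summable fun j => (2 * (Real.sinh (θ j) * (((starRingEnd ℂ) (w j) * v (σ j)).im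
      + ((starRingEnd ℂ) (v j) * w (σ j)).im))
      + (c2 * ‖v j‖ ^ 2 + 2 * c * ((starRingEnd ℂ) (v j) * w j).re)) := by
    refine (((s1.add s2).mul_left 2).add ((sv.mul_left c2).add (sre.mul_left (2 * c)))).congr
      fun j => ?_
    ring
  have hs := ((sq.sub (sF.mul_left (1 / 2))).add sYσ).tsum_le_tsum hle stot
  rw [(sq.sub (sF.mul_left (1 / 2))).tsum_add sYσ, tsum_comp_sub_self σ sY,
    sq.tsum_sub (sF.mul_left (1 / 2)), tsum_mul_left] at hs
  have hq' := (sv.mul_left (M ^ 2 / 2)).tsum_le_tsum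
    (fun j => mul_le_mul_of_nonneg_right (hq j) (sq_nonneg ‖v j‖)) sq
  rw [tsum_mul_left] at hq'
  linarith

/-- The antisymmetric part does not change the norm, so the derivative of `‖v‖ ^ 2` is twice the
energy plus the contribution of `F`. -/
theorem abs_tsum_re_sub_energy_le (h : EdgeDominated σ θ m r) (hM : 0 < M)
    (hv : ∀ j, ‖v j‖ ≤ m j) (hF : ∀ j, ‖F j‖ ≤ m j)
    (heq : ∀ j, w j = c * v j + Complex.I * (Real.exp (-θ j) * v (σ j)
      + Real.exp (θ (σ.symm j)) * v (σ.symm j)) + F j)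
    (hFM : ∑' j, ‖F j‖ ^ 2 ≤ M ^ 2 * ∑' j, ‖v j‖ ^ 2) :
    |∑' j, 2 * ((starRingEnd ℂ) (v j) * w j).re
      - 2 * ∑' j, (2 * (Real.sinh (θ j) * ((starRingEnd ℂ) (v j) * v (σ j)).im)
        + c * ‖v j‖ ^ 2)| ≤ 2 * M * ∑' j, ‖v j‖ ^ 2 := by
  have hsinh : ∀ j, |Real.sinh (θ j)| ≤ Real.exp |θ j| := fun j => Real.abs_sinh_le_exp_abs _
  have hexp : ∀ j, |Real.exp (θ j)| ≤ Real.exp |θ j| := fun j => by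
    rw [Real.abs_exp]; exact Real.exp_le_exp.2 (le_abs_self _)
  have sv := h.summable_norm_sq hv
  have sF := h.summable_norm_sq hF
  have s1 := h.summable_current hsinh hv hv
  have s2 := h.summable_current hexp hv hv
  have sreF := h.summable_re hv hF
  -- Shifting the incoming current by one site combines `exp (θ j)` with `exp (-θ j)` into `2 * sinh
  -- (θ j)`.
  set Z : ι → ℝ := fun j => 2 * (Real.exp (θ (σ.symm j)) *
      ((starRingEnd ℂ) (v (σ.symm j)) * v (σ (σ.symm j))).im) with hZ
  have sZ : Summable Z := (σ.symm.summable_iff.2 s2).mul_left 2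
  have sZσ : Summable fun j => Z (σ j) - Z j := (σ.summable_iff.2 sZ).sub sZ
  have sD := (s1.mul_left 2).add (sv.mul_left c)
  have hpt : ∀ j, 2 * ((starRingEnd ℂ) (v j) * w j).re
      = 2 * (2 * (Real.sinh (θ j) * ((starRingEnd ℂ) (v j) * v (σ j)).im) + c * ‖v j‖ ^ 2)
        - (Z (σ j) - Z j) + 2 * ((starRingEnd ℂ) (v j) * F j).re := by
    intro j
    simp only [hZ, Equiv.symm_apply_apply, Equiv.apply_symm_apply, heq j, Real.sinh_eq,
      ← Complex.normSq_eq_norm_sq, Complex.normSq_apply, Complex.mul_re, Complex.mul_im,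
      Complex.conj_re, Complex.conj_im, Complex.add_re, Complex.add_im, Complex.ofReal_re,
      Complex.ofReal_im, Complex.I_re, Complex.I_im]
    ring
  have hsum : ∑' j, 2 * ((starRingEnd ℂ) (v j) * w j).re
      = 2 * ∑' j, (2 * (Real.sinh (θ j) * ((starRingEnd ℂ) (v j) * v (σ j)).im)
        + c * ‖v j‖ ^ 2) + ∑' j, 2 * ((starRingEnd ℂ) (v j) * F j).re := by
    rw [tsum_congr hpt, ((sD.mul_left 2).sub sZσ).tsum_add (sreF.mul_left 2),
      (sD.mul_left 2).tsum_sub sZσ, tsum_comp_sub_self σ sZ, tsum_mul_left, sub_zero]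
  rw [hsum, add_sub_cancel_left]
  have hb : ∀ j, |2 * ((starRingEnd ℂ) (v j) * F j).re| ≤ M * ‖v j‖ ^ 2 + M⁻¹ * ‖F j‖ ^ 2 := by
    intro j
    rw [abs_mul, abs_two]
    have h1 := Complex.abs_re_conj_mul_le (le_refl ‖v j‖) (le_refl ‖F j‖)
    have h2 : M * ‖v j‖ ^ 2 + M⁻¹ * ‖F j‖ ^ 2 - 2 * (‖v j‖ * ‖F j‖)
        = M * (‖v j‖ - M⁻¹ * ‖F j‖) ^ 2 := by field_simp; ring
    have h3 : 0 ≤ M * (‖v j‖ - M⁻¹ * ‖F j‖) ^ 2 := by positivity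
    linarith
  have sb := (sv.mul_left M).add (sF.mul_left M⁻¹)
  have h1 : |∑' j, 2 * ((starRingEnd ℂ) (v j) * F j).re|
      ≤ ∑' j, (M * ‖v j‖ ^ 2 + M⁻¹ * ‖F j‖ ^ 2) :=
    tsum_of_norm_bounded (f := fun j => 2 * ((starRingEnd ℂ) (v j) * F j).re) sb.hasSum hb
  rw [(sv.mul_left M).tsum_add (sF.mul_left M⁻¹), tsum_mul_left (f := fun j => ‖v j‖ ^ 2),
    tsum_mul_left (f := fun j => ‖F j‖ ^ 2)] at h1
  have h2 : M⁻¹ * ∑' j, ‖F j‖ ^ 2 ≤ M * ∑' j, ‖v j‖ ^ 2 := by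
    calc _ ≤ M⁻¹ * (M ^ 2 * ∑' j, ‖v j‖ ^ 2) := by gcongr
      _ = _ := by field_simp
  linarith

end

/-! ### Energy monotonicity and the two-endpoint bound for conjugated solutions -/

section

variable {v w : ℝ → ℂ} {v' w' : ℂ} {a b t : ℝ}

theorem HasDerivAt.im_conj_mul (hv : HasDerivAt v v' t) (hw : HasDerivAt w w' t) :
    HasDerivAt (fun s => ((starRingEnd ℂ) (v s) * w s).im)
      (((starRingEnd ℂ) v' * w t).im + ((starRingEnd ℂ) (v t) * w').im) t :=
  Complex.imCLM.hasFDerivAt.comp_hasDerivAt t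
    ((Complex.conjCLE.toContinuousLinearMap.hasFDerivAt.comp_hasDerivAt t hv).mul hw)

theorem HasDerivAt.norm_sq_re (hv : HasDerivAt v v' t) :
    HasDerivAt (fun s => ‖v s‖ ^ 2) (2 * ((starRingEnd ℂ) (v t) * v').re) t := by
  have := hv.norm_sq
  rwa [Complex.inner, mul_comm v'] at this

theorem AbsolutelyContinuousOnInterval.conj_mul (hv : AbsolutelyContinuousOnInterval v a b)
    (hw : AbsolutelyContinuousOnInterval w a b) :
    AbsolutelyContinuousOnInterval (fun s => (starRingEnd ℂ) (v s) * w s) a b :=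
  (hv.clm_comp Complex.conjCLE.toContinuousLinearMap).fun_smul hw

theorem AbsolutelyContinuousOnInterval.im_conj_mul (hv : AbsolutelyContinuousOnInterval v a b)
    (hw : AbsolutelyContinuousOnInterval w a b) :
    AbsolutelyContinuousOnInterval (fun s => ((starRingEnd ℂ) (v s) * w s).im) a b :=
  (hv.conj_mul hw).clm_comp Complex.imCLM

theorem AbsolutelyContinuousOnInterval.norm_sq (hv : AbsolutelyContinuousOnInterval v a b) :
    AbsolutelyContinuousOnInterval (fun s => ‖v s‖ ^ 2) a b := by
  have h : (fun s => ‖v s‖ ^ 2) = fun s => Complex.reCLM ((starRingEnd ℂ) (v s) * v s) := by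
    funext s
    rw [Complex.reCLM_apply, ← Complex.normSq_eq_conj_mul_self, Complex.ofReal_re,
      Complex.normSq_eq_norm_sq]
  rw [h]
  exact (hv.conj_mul hv).clm_comp Complex.reCLM

end

/-- A family of absolutely continuous sequences solving a hopping equation conjugated by a weight
with increments `θ` in space and logarithmic time derivative `A + B * t`. -/
structure IsConjugatedSolution {ι : Type*} (σ : Equiv.Perm ι) (θ m r : ι → ℝ) (A B M : ℝ)
    (v w F : ℝ → ι → ℂ) : Prop where
  dominated : EdgeDominated σ θ m r
  ac : ∀ j, AbsolutelyContinuousOnInterval (fun t => v t j) 0 1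
  norm_le : ∀ t ∈ Icc (0 : ℝ) 1, ∀ j, ‖v t j‖ ≤ m j
  equation : ∀ᵐ t : ℝ, t ∈ Ioo (0 : ℝ) 1 →
    (∀ j, HasDerivAt (fun s => v s j) (w t j) t ∧ ‖w t j‖ ≤ m j ∧ ‖F t j‖ ≤ m j ∧
      w t j = ((A + B * t : ℝ) : ℂ) * v t j + Complex.I * (Real.exp (-θ j) * v t (σ j)
        + Real.exp (θ (σ.symm j)) * v t (σ.symm j)) + F t j) ∧
    ∑' j, ‖F t j‖ ^ 2 ≤ M ^ 2 * ∑' j, ‖v t j‖ ^ 2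

namespace IsConjugatedSolution

variable {ι : Type*} [Countable ι] {σ : Equiv.Perm ι} {θ m r : ι → ℝ} {A B M : ℝ}
  {v w F : ℝ → ι → ℂ}

/-- The sign `ε` treats growth forward and backward in time at once; the exponential factor
compensates the error `2 * M * ‖v‖ ^ 2`. -/
theorem sign_exp_mul_tsum_le (h : IsConjugatedSolution σ θ m r A B M v w F) (hM : 0 ≤ M)
    {ε : ℝ} (hε : ε ^ 2 = 1) {s t : ℝ} (hs : 0 ≤ s) (hst : s ≤ t) (ht : t ≤ 1)
    (hpos : ∀ᵐ x, x ∈ Ioo s t → 0 ≤ 2 * M * ∑' j, ‖v x j‖ ^ 2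
      + ε * ∑' j, 2 * ((starRingEnd ℂ) (v x j) * w x j).re) :
    ε * (Real.exp (2 * M * ε * s) * ∑' j, ‖v s j‖ ^ 2)
      ≤ ε * (Real.exp (2 * M * ε * t) * ∑' j, ‖v t j‖ ^ 2) := by
  have hdom := h.dominated
  have hεa : |ε| = 1 := by
    rw [← abs_one (α := ℝ)]
    exact (sq_eq_sq_iff_abs_eq_abs ε 1).1 (by rw [hε, one_pow])
  have hsub : ∀ x ∈ Icc s t, x ∈ Icc (0 : ℝ) 1 := fun x hx => ⟨hs.trans hx.1, hx.2.trans ht⟩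
  have hsum : ∀ x ∈ Icc s t, Summable fun j => ε * (Real.exp (2 * M * ε * x) * ‖v x j‖ ^ 2) :=
    fun x hx => ((hdom.summable_norm_sq (h.norm_le x (hsub x hx))).mul_left _).mul_left _
  have key := tsum_le_tsum_of_ae_deriv_nonneg
    (f := fun j x => ε * (Real.exp (2 * M * ε * x) * ‖v x j‖ ^ 2))
    (f' := fun j x => Real.exp (2 * M * ε * x) * (2 * M * ‖v x j‖ ^ 2
      + ε * (2 * ((starRingEnd ℂ) (v x j) * w x j).re)))
    (B := fun j => Real.exp (2 * M) * ((2 * M + 2) * (r j * m j ^ 2))) hst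
    (fun j => by
      refine AbsolutelyContinuousOnInterval.const_mul ε (AbsolutelyContinuousOnInterval.fun_mul
        ?_ (((h.ac j).mono ?_).norm_sq))
      · exact ContDiffOn.absolutelyContinuousOnInterval (by fun_prop)
      · rw [uIcc_of_le hst, uIcc_of_le zero_le_one]; exact hsub)
    ((hdom.summable.mul_left _).mul_left _)
    (by
      filter_upwards [hpos, h.equation] with x hx1 hx2 hx
      have hx01 : x ∈ Ioo (0 : ℝ) 1 := ⟨hs.trans_lt hx.1, hx.2.trans_le ht⟩
      have hvx := h.norm_le x (Ioo_subset_Icc_self hx01)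
      have hwx := fun j => ((hx2 hx01).1 j).2.1
      refine ⟨fun j => ⟨?_, ?_⟩, ?_⟩
      · have hd := ((hx2 hx01).1 j).1.norm_sq_re
        have he : HasDerivAt (fun y => Real.exp (2 * M * ε * y))
            (Real.exp (2 * M * ε * x) * (2 * M * ε)) x := by
          simpa using ((hasDerivAt_id x).const_mul (2 * M * ε)).exp
        refine ((he.fun_mul hd).const_mul ε).congr_deriv ?_
        linear_combination (Real.exp (2 * M * ε * x) * (2 * M * ‖v x j‖ ^ 2)) * hε
      · rw [abs_mul, Real.abs_exp]
        have h1 : Real.exp (2 * M * ε * x) ≤ Real.exp (2 * M) := by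
          apply Real.exp_le_exp.2
          have : ε * x ≤ 1 := by
            calc ε * x ≤ |ε * x| := le_abs_self _
              _ = x := by rw [abs_mul, hεa, one_mul, abs_of_pos hx01.1]
              _ ≤ 1 := hx01.2.le
          nlinarith
        have h2 : |2 * M * ‖v x j‖ ^ 2 + ε * (2 * ((starRingEnd ℂ) (v x j) * w x j).re)|
            ≤ (2 * M + 2) * (r j * m j ^ 2) := by
          refine (abs_add_le _ _).trans ?_
          rw [abs_mul ε, hεa, one_mul, abs_mul 2, abs_two, abs_of_nonneg (by positivity), add_mul]
          gcongr
          · exact (pow_le_pow_left₀ (norm_nonneg _) (hvx j) 2).trans (hdom.sq_le j)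
          · exact hdom.abs_re_le hvx hwx j
        gcongr
      · have s1 := (hdom.summable_norm_sq hvx).mul_left (2 * M)
        have s2 := ((hdom.summable_re hvx hwx).mul_left 2).mul_left ε
        rw [tsum_mul_left, s1.tsum_add s2, tsum_mul_left (f := fun j => ‖v x j‖ ^ 2),
          tsum_mul_left (a := ε)]
        exact mul_nonneg (Real.exp_pos _).le (hx1 hx))
    (hsum s (left_mem_Icc.2 hst)) (hsum t (right_mem_Icc.2 hst))
  simpa only [tsum_mul_left] using key

theorem energy_le_energy (h : IsConjugatedSolution σ θ m r A B M v w F)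
    (hq : ∀ j, M ^ 2 / 2 ≤ B + commutatorWeight σ θ j) {s t : ℝ} (hs : 0 ≤ s) (hst : s ≤ t)
    (ht : t ≤ 1) :
    ∑' j, (2 * (Real.sinh (θ j) * ((starRingEnd ℂ) (v s j) * v s (σ j)).im)
        + (A + B * s) * ‖v s j‖ ^ 2)
      ≤ ∑' j, (2 * (Real.sinh (θ j) * ((starRingEnd ℂ) (v t j) * v t (σ j)).im)
        + (A + B * t) * ‖v t j‖ ^ 2) := by
  have hdom := h.dominated
  have hsinh : ∀ j, |Real.sinh (θ j)| ≤ Real.exp |θ j| := fun j => Real.abs_sinh_le_exp_abs _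
  have hsub : ∀ x ∈ Icc s t, x ∈ Icc (0 : ℝ) 1 := fun x hx => ⟨hs.trans hx.1, hx.2.trans ht⟩
  have hsub' : uIcc s t ⊆ uIcc 0 1 := by
    rw [uIcc_of_le hst, uIcc_of_le zero_le_one]; exact hsub
  have hsum : ∀ x ∈ Icc s t, Summable fun j =>
      2 * (Real.sinh (θ j) * ((starRingEnd ℂ) (v x j) * v x (σ j)).im)
        + (A + B * x) * ‖v x j‖ ^ 2 := fun x hx =>
    ((hdom.summable_current hsinh (h.norm_le x (hsub x hx)) (h.norm_le x (hsub x hx))).mul_left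
      2).add ((hdom.summable_norm_sq (h.norm_le x (hsub x hx))).mul_left _)
  refine tsum_le_tsum_of_ae_deriv_nonneg
    (f := fun j x => 2 * (Real.sinh (θ j) * ((starRingEnd ℂ) (v x j) * v x (σ j)).im)
        + (A + B * x) * ‖v x j‖ ^ 2)
    (f' := fun j x => 2 * (Real.sinh (θ j) * (((starRingEnd ℂ) (w x j) * v x (σ j)).im
      + ((starRingEnd ℂ) (v x j) * w x (σ j)).im))
      + (B * ‖v x j‖ ^ 2 + 2 * (A + B * x) * ((starRingEnd ℂ) (v x j) * w x j).re))
    (B := fun j => 4 * (r j * m j ^ 2 + r (σ j) * m (σ j) ^ 2)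
      + (|B| + 2 * (|A| + |B|)) * (r j * m j ^ 2)) hst (fun j => ?_)
    ((hdom.summable_next.mul_left _).add (hdom.summable.mul_left _)) ?_
    (hsum s (left_mem_Icc.2 hst)) (hsum t (right_mem_Icc.2 hst))
  · refine AbsolutelyContinuousOnInterval.fun_add (AbsolutelyContinuousOnInterval.const_mul _
      (AbsolutelyContinuousOnInterval.const_mul _ (((h.ac j).mono hsub').im_conj_mul
        ((h.ac (σ j)).mono hsub')))) (AbsolutelyContinuousOnInterval.fun_mul
        ?_ (((h.ac j).mono hsub').norm_sq))
    exact ContDiffOn.absolutelyContinuousOnInterval (by fun_prop)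
  · filter_upwards [h.equation] with x hx2 hx
    have hx01 : x ∈ Ioo (0 : ℝ) 1 := ⟨hs.trans_lt hx.1, hx.2.trans_le ht⟩
    have hvx := h.norm_le x (Ioo_subset_Icc_self hx01)
    have hwx := fun j => ((hx2 hx01).1 j).2.1
    have hFx := fun j => ((hx2 hx01).1 j).2.2.1
    refine ⟨fun j => ⟨?_, ?_⟩, ?_⟩
    · have hd := ((hx2 hx01).1 j).1
      have hdσ := ((hx2 hx01).1 (σ j)).1
      have hl : HasDerivAt (fun y => A + B * y) B x := by
        simpa using ((hasDerivAt_id x).const_mul B).const_add A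
      refine ((((hd.im_conj_mul hdσ).const_mul (Real.sinh (θ j))).const_mul 2).fun_add
        (hl.fun_mul hd.norm_sq_re)).congr_deriv ?_
      ring
    · have b1 := hdom.abs_current_le hsinh hwx hvx j
      have b2 := hdom.abs_current_le hsinh hvx hwx j
      have b3 := hdom.abs_re_le hvx hwx j
      have b4 : |B * ‖v x j‖ ^ 2| ≤ |B| * (r j * m j ^ 2) := by
        rw [abs_mul, abs_of_nonneg (sq_nonneg ‖v x j‖)]
        gcongr
        exact (pow_le_pow_left₀ (norm_nonneg _) (hvx j) 2).trans (hdom.sq_le j)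
      have b5 : |2 * (A + B * x) * ((starRingEnd ℂ) (v x j) * w x j).re|
          ≤ 2 * (|A| + |B|) * (r j * m j ^ 2) := by
        rw [abs_mul, abs_mul, abs_two]
        gcongr
        refine (abs_add_le _ _).trans ?_
        rw [abs_mul, abs_of_pos hx01.1]
        gcongr
        exact mul_le_of_le_one_right (abs_nonneg _) hx01.2.le
      have b6 : |2 * (Real.sinh (θ j) * (((starRingEnd ℂ) (w x j) * v x (σ j)).im
          + ((starRingEnd ℂ) (v x j) * w x (σ j)).im))|
          ≤ 4 * (r j * m j ^ 2 + r (σ j) * m (σ j) ^ 2) := by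
        rw [abs_mul, abs_two, mul_add]
        linarith [abs_add_le (Real.sinh (θ j) * ((starRingEnd ℂ) (w x j) * v x (σ j)).im)
          (Real.sinh (θ j) * ((starRingEnd ℂ) (v x j) * w x (σ j)).im)]
      rw [add_mul]
      exact (abs_add_le _ _).trans (add_le_add b6 ((abs_add_le _ _).trans (add_le_add b4 b5)))
    · exact tsum_energy_deriv_nonneg hdom hvx hwx hFx (fun j => ((hx2 hx01).1 j).2.2.2)
        (hx2 hx01).2 hq

/-- If the commutator dominates the perturbation, the weighted norm of a solution at any time is
controlled by its values at the end points. -/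
theorem tsum_norm_sq_le (h : IsConjugatedSolution σ θ m r A B M v w F) (hM : 0 < M)
    (hq : ∀ j, M ^ 2 / 2 ≤ B + commutatorWeight σ θ j) {t : ℝ} (ht : t ∈ Icc (0 : ℝ) 1) :
    ∑' j, ‖v t j‖ ^ 2
      ≤ Real.exp (2 * M) * (∑' j, ‖v 0 j‖ ^ 2 + ∑' j, ‖v 1 j‖ ^ 2) := by
  have hdom := h.dominated
  have hn : ∀ s, 0 ≤ ∑' j, ‖v s j‖ ^ 2 := fun s => tsum_nonneg fun _ => sq_nonneg _
  set D : ℝ → ℝ := fun s =>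
    ∑' j, (2 * (Real.sinh (θ j) * ((starRingEnd ℂ) (v s j) * v s (σ j)).im)
        + (A + B * s) * ‖v s j‖ ^ 2) with hD
  have hDmono : ∀ {s t : ℝ}, 0 ≤ s → s ≤ t → t ≤ 1 → D s ≤ D t :=
    fun hs hst ht => h.energy_le_energy hq hs hst ht
  have habs : ∀ᵐ x, x ∈ Ioo (0 : ℝ) 1 → |∑' j, 2 * ((starRingEnd ℂ) (v x j) * w x j).re
      - 2 * D x| ≤ 2 * M * ∑' j, ‖v x j‖ ^ 2 := by
    filter_upwards [h.equation] with x hx2 hx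
    exact abs_tsum_re_sub_energy_le hdom hM (h.norm_le x (Ioo_subset_Icc_self hx))
      (fun j => ((hx2 hx).1 j).2.2.1)
      (fun j => ((hx2 hx).1 j).2.2.2) (hx2 hx).2
  -- As `D` is nondecreasing, `D t ≤ 0` keeps it nonpositive on `[0, t]`, so the norm is compared
  -- with time `0`; otherwise it stays nonnegative on `[t, 1]`, and time `1` serves.
  rcases le_total (D t) 0 with hDt | hDt
  · have key := h.sign_exp_mul_tsum_le hM.le (ε := -1) (by norm_num) le_rfl ht.1 ht.2 (by
      filter_upwards [habs] with x hx hx0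
      have h1 := abs_le.1 (hx ⟨hx0.1, hx0.2.trans_le ht.2⟩)
      have h2 := hDmono hx0.1.le hx0.2.le ht.2
      linarith [h1.2])
    have h3 : Real.exp (2 * M * -1 * t) * ∑' j, ‖v t j‖ ^ 2 ≤ ∑' j, ‖v 0 j‖ ^ 2 := by
      simpa using key
    calc ∑' j, ‖v t j‖ ^ 2
        = Real.exp (2 * M * t) * (Real.exp (2 * M * -1 * t) * ∑' j, ‖v t j‖ ^ 2) := by
          rw [← mul_assoc, ← Real.exp_add]; ring_nf; simp
      _ ≤ Real.exp (2 * M) * ∑' j, ‖v 0 j‖ ^ 2 := by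
          refine mul_le_mul (Real.exp_le_exp.2 ?_) h3
            (mul_nonneg (Real.exp_pos _).le (hn t)) (Real.exp_pos _).le
          nlinarith [ht.2]
      _ ≤ _ := by
          gcongr
          linarith [hn 1]
  · have key := h.sign_exp_mul_tsum_le hM.le (ε := 1) (by norm_num) ht.1 ht.2 le_rfl (by
      filter_upwards [habs] with x hx hx0
      have h1 := abs_le.1 (hx ⟨ht.1.trans_lt hx0.1, hx0.2⟩)
      have h2 := hDmono ht.1 hx0.1.le hx0.2.le
      linarith [h1.1])
    simp only [one_mul, mul_one] at key
    calc ∑' j, ‖v t j‖ ^ 2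
        ≤ Real.exp (2 * M * t) * ∑' j, ‖v t j‖ ^ 2 :=
          le_mul_of_one_le_left (hn t) (Real.one_le_exp (by have := ht.1; positivity))
      _ ≤ Real.exp (2 * M) * ∑' j, ‖v 1 j‖ ^ 2 := key
      _ ≤ _ := by
          gcongr
          linarith [hn 0]

end IsConjugatedSolution

/-! ### Decay on the lattice -/

theorem summable_pi_prod {α : Type*} {f : α → ℝ} (hf : Summable f) (h0 : ∀ a, 0 ≤ f a) (d : ℕ) :
    Summable fun j : Fin d → α => ∏ k, f (j k) := by
  induction d with
  | zero => exact Summable.of_finite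
  | succ n ih =>
    rw [← (Fin.consEquiv fun _ : Fin (n + 1) => α).summable_iff]
    refine (hf.mul_of_nonneg ih h0 fun j => Finset.prod_nonneg fun _ _ => h0 _).congr fun p => ?_
    simp [Fin.prod_univ_succ, Fin.consEquiv]

/-- The `ℓ¹` norm on the lattice. -/
noncomputable def normOneLattice {d : ℕ} (j : IntLattice d) : ℝ := ∑ k : Fin d, |(j k : ℝ)|

section

variable {d : ℕ}

theorem abs_coord_le_normOneLattice (j : IntLattice d) (k : Fin d) :
    |(j k : ℝ)| ≤ normOneLattice j :=
  Finset.single_le_sum (f := fun k => |(j k : ℝ)|) (fun _ _ => abs_nonneg _) (Finset.mem_univ k)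

theorem normOneLattice_le_add (j i : IntLattice d) :
    normOneLattice j ≤ normOneLattice (j + i) + normOneLattice i := by
  rw [normOneLattice, normOneLattice, normOneLattice, ← Finset.sum_add_distrib]
  refine Finset.sum_le_sum fun k _ => ?_
  rw [Pi.add_apply, Int.cast_add]
  calc |(j k : ℝ)| = |(j k + i k : ℝ) - i k| := by rw [add_sub_cancel_right]
    _ ≤ _ := abs_sub _ _

theorem normOneLattice_single (k : Fin d) : normOneLattice (Pi.single k (1 : ℤ)) = 1 := by
  rw [normOneLattice, Finset.sum_eq_single k]
  · simp
  · intro b _ hb; simp [hb]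
  · simp

theorem normOneLattice_neg (j : IntLattice d) : normOneLattice (-j) = normOneLattice j := by
  simp [normOneLattice]

theorem normOneLattice_sub_one_le_add_single (j : IntLattice d) (k : Fin d) :
    normOneLattice j - 1 ≤ normOneLattice (j + Pi.single k 1) := by
  have := normOneLattice_le_add j (Pi.single k 1)
  rw [normOneLattice_single] at this
  linarith

theorem normOneLattice_sub_one_le_sub_single (j : IntLattice d) (k : Fin d) :
    normOneLattice j - 1 ≤ normOneLattice (j - Pi.single k 1) := by
  have := normOneLattice_le_add j (-Pi.single k 1)
  rw [normOneLattice_neg, normOneLattice_single, ← sub_eq_add_neg] at this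
  linarith

theorem summable_exp_neg_normOneLattice {b : ℝ} (hb : 0 < b) :
    Summable fun j : IntLattice d => Real.exp (-b * normOneLattice j) := by
  have h1 : Summable fun n : ℤ => Real.exp (-b * |(n : ℝ)|) := by
    have hN : Summable fun n : ℕ => Real.exp (n * -b) :=
      Real.summable_exp_nat_mul_iff.2 (by linarith)
    refine Summable.of_nat_of_neg ?_ ?_ <;>
      refine hN.congr fun n => ?_ <;> simp [mul_comm]
  refine (summable_pi_prod h1 (fun _ => (Real.exp_pos _).le) d).congr fun j => ?_
  rw [← Real.exp_sum, normOneLattice, Finset.mul_sum]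

theorem mul_normOneLattice_le {lam : ℝ} (hlam : 0 < lam) (b : ℝ) (j : IntLattice d) :
    b * normOneLattice j ≤ lam * normSqLattice j + d * (b ^ 2 / (4 * lam)) := by
  have h : ∀ k : Fin d, b * |(j k : ℝ)| ≤ lam * (j k : ℝ) ^ 2 + b ^ 2 / (4 * lam) := by
    intro k
    rw [← sq_abs (j k : ℝ)]
    have : lam * |(j k : ℝ)| ^ 2 + b ^ 2 / (4 * lam) - b * |(j k : ℝ)|
        = lam * (|(j k : ℝ)| - b / (2 * lam)) ^ 2 := by field_simp; ring
    have : 0 ≤ lam * (|(j k : ℝ)| - b / (2 * lam)) ^ 2 := by positivity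
    linarith
  calc b * normOneLattice j = ∑ k, b * |(j k : ℝ)| := by rw [normOneLattice, Finset.mul_sum]
    _ ≤ ∑ k : Fin d, (lam * (j k : ℝ) ^ 2 + b ^ 2 / (4 * lam)) := Finset.sum_le_sum fun k _ => h k
    _ = _ := by
      rw [Finset.sum_add_distrib, ← Finset.mul_sum, normSqLattice]; simp

theorem norm_discreteLaplacian_le {v : IntLattice d → ℂ} {j : IntLattice d} {a b : ℝ}
    (h0 : ‖v j‖ ≤ a) (h1 : ∀ k, ‖v (j + Pi.single k 1)‖ ≤ b)
    (h2 : ∀ k, ‖v (j - Pi.single k 1)‖ ≤ b) :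
    ‖discreteLaplacian v j‖ ≤ d * (2 * a + 2 * b) := by
  rw [discreteLaplacian]
  refine (norm_sum_le_of_le (n := fun _ => 2 * a + 2 * b) _ fun k _ => ?_).trans_eq
    (by simp [mul_add])
  have h3 : ‖2 * v j‖ ≤ 2 * a := by
    rw [norm_mul, RCLike.norm_ofNat]; linarith
  linarith [norm_add_le (v (j + Pi.single k 1) - 2 * v j) (v (j - Pi.single k 1)),
    norm_sub_le (v (j + Pi.single k 1)) (2 * v j), h1 k, h2 k]

end

/-! ### Propagation of exponential decay from the initial time -/

namespace IsSchrodingerSolution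

variable {d : ℕ} {V : IntLattice d → ℝ → ℂ} {u : ℝ → EllTwo d}

theorem ae_equation (hu : IsSchrodingerSolution V u) : ∀ᵐ t : ℝ, t ∈ Ioo (0 : ℝ) 1 →
    ∀ j, HasDerivAt (fun s => u s j)
      (Complex.I * (discreteLaplacian (u t) j + V j t * u t j)) t := by
  filter_upwards [ae_all_iff.2 hu.equation] with t ht ht01 j using ht j ht01

theorem exists_norm_le (hu : IsSchrodingerSolution V u) :
    ∃ U : ℝ, ∀ t ∈ Icc (0 : ℝ) 1, ∀ j, ‖u t j‖ ≤ U := by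
  obtain ⟨U, hU⟩ := isCompact_Icc.exists_bound_of_continuousOn hu.continuousOn
  exact ⟨U, fun t ht j => (lp.norm_apply_le_norm two_ne_zero (u t) j).trans (hU t ht)⟩

/-- Exponential decay at the initial time persists. -/
theorem norm_le_of_initial_decay (hu : IsSchrodingerSolution V u) {C0 : ℝ} (hC0 : 0 ≤ C0)
    (hV : ∀ j, ∀ t ∈ Icc (0 : ℝ) 1, ‖V j t‖ ≤ C0) {K b : ℝ} (hK : 0 ≤ K) (hb : 0 ≤ b)
    (h0 : ∀ j, ‖u 0 j‖ ≤ K * Real.exp (-b * normOneLattice j)) {t : ℝ}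
    (ht : t ∈ Icc (0 : ℝ) 1) (j : IntLattice d) :
    ‖u t j‖ ≤ K * Real.exp (-b * normOneLattice j)
      * Real.exp ((d * (2 + 2 * Real.exp b) + C0) * t) := by
  obtain ⟨U, hU⟩ := hu.exists_norm_le
  have hU0 : 0 ≤ U := (norm_nonneg _).trans (hU 0 (by simp) j)
  set B : ℝ := d * (2 + 2 * Real.exp b) + C0 with hB
  have hB0 : 0 ≤ B := by positivity
  -- Picard iteration: starting from the uniform bound `U`, each integration of the equation
  -- improves the remainder by one order in `B * t`, and the remainder vanishes as `n → ∞`.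
  have hind : ∀ n : ℕ, ∀ t ∈ Icc (0 : ℝ) 1, ∀ j, ‖u t j‖ ≤
      K * Real.exp (-b * normOneLattice j) * Real.exp (B * t)
        + U * ((B * t) ^ n / n.factorial) := by
    intro n
    induction n with
    | zero =>
      intro t ht j
      have := hU t ht j
      have h1 : 0 ≤ K * Real.exp (-b * normOneLattice j) * Real.exp (B * t) := by positivity
      rw [pow_zero, Nat.factorial_zero, Nat.cast_one, div_one, mul_one]
      linarith
    | succ n ih =>
      intro t ht j
      set E : ℝ := K * Real.exp (-b * normOneLattice j) with hE
      have hE0 : 0 ≤ E := by positivity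
      have hsub : uIcc 0 t ⊆ uIcc (0 : ℝ) 1 := by
        rw [uIcc_of_le ht.1, uIcc_of_le zero_le_one]; exact Icc_subset_Icc_right ht.2
      have key := AbsolutelyContinuousOnInterval.norm_sub_le
        (f' := fun s => Complex.I * (discreteLaplacian (u s) j + V j s * u s j))
        (φ := fun s => E * Real.exp (B * s) + U * ((B * s) ^ (n + 1) / (n + 1).factorial))
        (φ' := fun s => B * (E * Real.exp (B * s) + U * ((B * s) ^ n / n.factorial)))
        ht.1 ((hu.absolutelyContinuous j).mono hsub)
        (ContDiffOn.absolutelyContinuousOnInterval (by fun_prop))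
        (fun x _ => by
          have h1 : HasDerivAt (fun s => B * s) B x := by
            simpa using (hasDerivAt_id x).const_mul B
          refine ((h1.exp.const_mul E).fun_add
            (((h1.fun_pow (n + 1)).div_const _).const_mul U)).congr_deriv ?_
          rw [Nat.factorial_succ]
          push_cast
          have h2 : (n.factorial : ℝ) ≠ 0 := by positivity
          have h3 : (n + 1 : ℝ) ≠ 0 := by positivity
          field_simp)
        (by
          filter_upwards [hu.ae_equation] with s hs hst
          have hs01 : s ∈ Ioo (0 : ℝ) 1 := ⟨hst.1, hst.2.trans_le ht.2⟩
          refine ⟨hs hs01 j, ?_⟩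
          have hsI := Ioo_subset_Icc_self hs01
          set R : ℝ := U * ((B * s) ^ n / n.factorial) with hR
          have hR0 : 0 ≤ R := by
            have := hs01.1
            positivity
          -- A neighbour can be closer to the origin by one, which costs the factor `exp b` built
          -- into `B`.
          have hnb : ∀ l : IntLattice d, normOneLattice j - 1 ≤ normOneLattice l →
              ‖u s l‖ ≤ Real.exp b * (E * Real.exp (B * s) + R) := by
            intro l hl
            refine (ih s hsI l).trans ?_
            rw [mul_add]
            refine add_le_add ?_ (le_mul_of_one_le_left hR0 (Real.one_le_exp hb))
            rw [← mul_assoc]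
            refine mul_le_mul_of_nonneg_right ?_ (Real.exp_pos _).le
            rw [hE, mul_left_comm, ← Real.exp_add]
            refine mul_le_mul_of_nonneg_left (Real.exp_le_exp.2 ?_) hK
            nlinarith
          have hΔ := norm_discreteLaplacian_le (v := u s) (ih s hsI j)
            (fun k => hnb _ (normOneLattice_sub_one_le_add_single j k))
            (fun k => hnb _ (normOneLattice_sub_one_le_sub_single j k))
          have hVu : ‖V j s * u s j‖ ≤ C0 * (E * Real.exp (B * s) + R) := by
            rw [norm_mul]
            exact mul_le_mul (hV j s hsI) (ih s hsI j) (norm_nonneg _) hC0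
          rw [norm_mul, Complex.norm_I, one_mul]
          refine (norm_add_le _ _).trans ((add_le_add hΔ hVu).trans_eq ?_)
          rw [hB]; ring)
      have h4 := norm_sub_norm_le (u t j) (u 0 j)
      have h5 := h0 j
      simp only [mul_zero, Real.exp_zero, mul_one, ne_eq, Nat.add_eq_zero_iff, one_ne_zero,
        and_false, not_false_eq_true, zero_pow, zero_div, add_zero] at key
      linarith
  have hlim : Filter.Tendsto (fun n : ℕ => K * Real.exp (-b * normOneLattice j)
      * Real.exp (B * t) + U * ((B * t) ^ n / n.factorial)) Filter.atTop
      (nhds (K * Real.exp (-b * normOneLattice j) * Real.exp (B * t) + U * 0)) :=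
    ((FloorSemiring.tendsto_pow_div_factorial_atTop (B * t)).const_mul U).const_add _
  rw [mul_zero, add_zero] at hlim
  exact ge_of_tendsto' hlim fun n => hind n t ht j

end IsSchrodingerSolution

/-! ### Conjugation by a weight in one coordinate -/

section

variable {d : ℕ}

/-- The part of the discrete Laplacian transversal to the `k`-th direction, with the diagonal. -/
theorem discreteLaplacian_sub_eq (v : IntLattice d → ℂ) (j : IntLattice d) (k : Fin d) :
    discreteLaplacian v j - (v (j + Pi.single k 1) + v (j - Pi.single k 1))
      = ∑ l ∈ Finset.univ.erase k, (v (j + Pi.single l 1) + v (j - Pi.single l 1))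
        - 2 * d * v j := by
  have h : discreteLaplacian v j
      = ∑ l, (v (j + Pi.single l 1) + v (j - Pi.single l 1)) - 2 * d * v j := by
    rw [discreteLaplacian]
    have : ∀ l : Fin d, v (j + Pi.single l 1) - 2 * v j + v (j - Pi.single l 1)
        = (v (j + Pi.single l 1) + v (j - Pi.single l 1)) - 2 * v j := fun l => by ring
    simp only [this, Finset.sum_sub_distrib, Finset.sum_const, Finset.card_univ,
      Fintype.card_fin, nsmul_eq_mul]
    ring
  rw [h, ← Finset.add_sum_erase _ _ (Finset.mem_univ k)]
  ring

/-- Cauchy–Schwarz over the directions, followed by translation invariance of the `ℓ²` sum. -/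
theorem tsum_norm_sq_transversal_le {v F : IntLattice d → ℂ} {c : ℝ} (k : Fin d)
    (hv : Summable fun j => ‖v j‖ ^ 2)
    (hF : ∀ j, ‖F j‖ ≤ ∑ l ∈ Finset.univ.erase k,
      (‖v (j + Pi.single l 1)‖ + ‖v (j - Pi.single l 1)‖) + c * ‖v j‖) :
    ∑' j, ‖F j‖ ^ 2 ≤ (8 * d ^ 2 + 2 * c ^ 2) * ∑' j, ‖v j‖ ^ 2 := by
  have s1 : ∀ l : Fin d, Summable fun j : IntLattice d => ‖v (j + Pi.single l 1)‖ ^ 2 :=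
    fun l => hv.comp_injective (add_left_injective (Pi.single l (1 : ℤ) : IntLattice d))
  have s2 : ∀ l : Fin d, Summable fun j : IntLattice d => ‖v (j - Pi.single l 1)‖ ^ 2 :=
    fun l => hv.comp_injective (sub_left_injective (b := (Pi.single l (1 : ℤ) : IntLattice d)))
  have t1 : ∀ l : Fin d, ∑' j : IntLattice d, ‖v (j + Pi.single l 1)‖ ^ 2 = ∑' j, ‖v j‖ ^ 2 :=
    fun l => (Equiv.addRight (Pi.single l (1 : ℤ))).tsum_eq fun j => ‖v j‖ ^ 2
  have t2 : ∀ l : Fin d, ∑' j : IntLattice d, ‖v (j - Pi.single l 1)‖ ^ 2 = ∑' j, ‖v j‖ ^ 2 :=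
    fun l => (Equiv.subRight (Pi.single l (1 : ℤ))).tsum_eq fun j => ‖v j‖ ^ 2
  have hb : ∀ j, ‖F j‖ ^ 2 ≤ 4 * d * (∑ l : Fin d,
      (‖v (j + Pi.single l 1)‖ ^ 2 + ‖v (j - Pi.single l 1)‖ ^ 2)) + 2 * c ^ 2 * ‖v j‖ ^ 2 := by
    intro j
    set x : Fin d → ℝ := fun l => ‖v (j + Pi.single l 1)‖ + ‖v (j - Pi.single l 1)‖ with hx
    have h1 : (∑ l ∈ Finset.univ.erase k, x l) ^ 2 ≤ d * ∑ l, x l ^ 2 := by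
      refine (sq_sum_le_card_mul_sum_sq (s := Finset.univ.erase k) (f := x)).trans ?_
      refine mul_le_mul ?_ (Finset.sum_le_sum_of_subset_of_nonneg (Finset.erase_subset _ _)
        fun _ _ _ => sq_nonneg _) (Finset.sum_nonneg fun _ _ => sq_nonneg _) (Nat.cast_nonneg _)
      exact_mod_cast (Finset.card_le_univ _).trans_eq (Fintype.card_fin d)
    have h2 : ∑ l, x l ^ 2 ≤ 2 * ∑ l : Fin d,
        (‖v (j + Pi.single l 1)‖ ^ 2 + ‖v (j - Pi.single l 1)‖ ^ 2) := by
      rw [Finset.mul_sum]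
      refine Finset.sum_le_sum fun l _ => ?_
      simp only [hx]
      nlinarith [sq_nonneg (‖v (j + Pi.single l 1)‖ - ‖v (j - Pi.single l 1)‖)]
    have h3 : ‖F j‖ ^ 2 ≤ (∑ l ∈ Finset.univ.erase k, x l + c * ‖v j‖) ^ 2 :=
      pow_le_pow_left₀ (norm_nonneg _) (hF j) 2
    have h4 : (d : ℝ) * ∑ l, x l ^ 2 ≤ d * (2 * ∑ l : Fin d,
        (‖v (j + Pi.single l 1)‖ ^ 2 + ‖v (j - Pi.single l 1)‖ ^ 2)) :=
      mul_le_mul_of_nonneg_left h2 (Nat.cast_nonneg _)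
    nlinarith [sq_nonneg (∑ l ∈ Finset.univ.erase k, x l - c * ‖v j‖)]
  have s3 : Summable fun j : IntLattice d => ∑ l : Fin d,
      (‖v (j + Pi.single l 1)‖ ^ 2 + ‖v (j - Pi.single l 1)‖ ^ 2) :=
    summable_sum fun l _ => (s1 l).add (s2 l)
  have s4 := (s3.mul_left (4 * d : ℝ)).add (hv.mul_left (2 * c ^ 2))
  refine ((Summable.of_nonneg_of_le (fun _ => sq_nonneg _) hb s4).tsum_le_tsum hb s4).trans_eq ?_
  rw [(s3.mul_left (4 * d : ℝ)).tsum_add (hv.mul_left (2 * c ^ 2)), tsum_mul_left,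
    tsum_mul_left, Summable.tsum_finsetSum fun l _ => (s1 l).add (s2 l),
    Finset.sum_congr rfl fun l _ => by rw [(s1 l).tsum_add (s2 l), t1, t2]]
  simp only [Finset.sum_const, Finset.card_univ, Fintype.card_fin, nsmul_eq_mul]
  ring

theorem abs_sub_le_of_growth {g : ℤ → ℝ} {L : ℝ} (hL : 0 ≤ L)
    (hg : ∀ n : ℤ, |g (n + 1) - g n| ≤ L * (1 + |(n : ℝ)|)) (n : ℤ) :
    |g n - g (n + 1)| ≤ L * (2 + |(n : ℝ)|) ∧ |g n - g (n - 1)| ≤ L * (2 + |(n : ℝ)|) := by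
  constructor
  · rw [abs_sub_comm]
    exact (hg n).trans (by gcongr; norm_num)
  · have := hg (n - 1)
    rw [sub_add_cancel] at this
    refine this.trans ?_
    push_cast
    have : |(n : ℝ) - 1| ≤ |(n : ℝ)| + 1 := by simpa using abs_sub (n : ℝ) 1
    exact mul_le_mul_of_nonneg_left (by linarith) hL

/-- The value at `j` of a weight with controlled growth, against a sequence at a nearby site. -/
theorem exp_mul_norm_le_of_near {g : ℤ → ℝ} {L K : ℝ} (hL : 0 ≤ L) (hK : 0 ≤ K) {k : Fin d}
    {v : IntLattice d → ℂ} {j l : IntLattice d}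
    (hv : Real.exp (g (l k)) * ‖v l‖ ≤ K * Real.exp (-(2 * L + 1) * normOneLattice l))
    (hgl : |g (j k) - g (l k)| ≤ L * (2 + |(j k : ℝ)|))
    (hl : normOneLattice j - 1 ≤ normOneLattice l) :
    Real.exp (g (j k)) * ‖v l‖
      ≤ K * Real.exp (4 * L + 1) * Real.exp (-(L + 1) * normOneLattice j) := by
  have h1 : Real.exp (g (j k)) * ‖v l‖
      = Real.exp (g (j k) - g (l k)) * (Real.exp (g (l k)) * ‖v l‖) := by
    rw [← mul_assoc, ← Real.exp_add, sub_add_cancel]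
  rw [h1, mul_assoc, ← Real.exp_add]
  calc _ ≤ Real.exp (g (j k) - g (l k))
        * (K * Real.exp (-(2 * L + 1) * normOneLattice l)) := by gcongr
    _ = K * Real.exp (g (j k) - g (l k) + -(2 * L + 1) * normOneLattice l) := by
        rw [mul_left_comm, ← Real.exp_add]
    _ ≤ _ := by
        -- With `ν` the `ℓ¹` norm of `j`, the exponent is at most `L * (2 + ν) - (2 * L + 1) * (ν -
        -- 1) = 4 * L + 1 - (L + 1) * ν`.
        refine mul_le_mul_of_nonneg_left (Real.exp_le_exp.2 ?_) hK
        have h2 := (le_abs_self _).trans hgl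
        have h3 := abs_coord_le_normOneLattice j k
        nlinarith

/-- The edges involved start within two steps of `j`, whence the `3`. The rate `L + 1` of `m` beats
the growth of `r`: the product `r * m ^ 2` decays like `exp (-2 * normOneLattice j)`. -/
theorem edgeDominated_lattice {g : ℤ → ℝ} {L K : ℝ} (hL : 0 ≤ L) (hK : 0 ≤ K) (k : Fin d)
    (hg : ∀ n : ℤ, |g (n + 1) - g n| ≤ L * (1 + |(n : ℝ)|)) :
    EdgeDominated (Equiv.addRight (Pi.single k (1 : ℤ)) : Equiv.Perm (IntLattice d))
      (fun j => g (j k + 1) - g (j k))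
      (fun j => K * Real.exp (-(L + 1) * normOneLattice j))
      (fun j => Real.exp (2 * (L * (3 + normOneLattice j)))) := by
  have hb : ∀ (j : IntLattice d) (n : ℤ), |(n : ℝ)| ≤ |(j k : ℝ)| + 2 →
      Real.exp (2 * |g (n + 1) - g n|) ≤ Real.exp (2 * (L * (3 + normOneLattice j))) := by
    intro j n hn
    refine Real.exp_le_exp.2 (mul_le_mul_of_nonneg_left ((hg n).trans ?_) zero_le_two)
    refine mul_le_mul_of_nonneg_left ?_ hL
    linarith [abs_coord_le_normOneLattice j k]
  refine ⟨fun j => by positivity, fun j => hb j _ (by linarith), fun j => ?_, fun j => ?_,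
    fun j => ?_, ?_⟩
  · refine hb j _ ?_
    simp only [Equiv.coe_addRight, Pi.add_apply, Pi.single_eq_same, Int.cast_add, Int.cast_one]
    linarith [abs_add_le (j k : ℝ) 1, abs_one (α := ℝ)]
  · refine hb j _ ?_
    simp only [Equiv.addRight_symm, Equiv.coe_addRight, Pi.add_apply, Pi.neg_apply,
      Pi.single_eq_same, Int.cast_add, Int.cast_neg, Int.cast_one]
    linarith [abs_add_le (j k : ℝ) (-1), abs_neg (1 : ℝ), abs_one (α := ℝ)]
  · refine hb j _ ?_
    simp only [Equiv.addRight_symm, Equiv.coe_addRight, Pi.add_apply, Pi.neg_apply,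
      Pi.single_eq_same, Int.cast_add, Int.cast_neg, Int.cast_one]
    linarith [abs_add_le (j k + -1 : ℝ) (-1), abs_add_le (j k : ℝ) (-1), abs_neg (1 : ℝ),
      abs_one (α := ℝ)]
  · refine ((summable_exp_neg_normOneLattice (d := d) zero_lt_two).mul_left
      (K ^ 2 * Real.exp (6 * L))).congr fun j => ?_
    rw [mul_pow, ← Real.exp_nat_mul, mul_left_comm, ← Real.exp_add, mul_assoc, ← Real.exp_add]
    congr 2
    push_cast
    ring

theorem commutatorWeight_lattice (g : ℤ → ℝ) (k : Fin d) (j : IntLattice d) :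
    commutatorWeight (Equiv.addRight (Pi.single k (1 : ℤ)) : Equiv.Perm (IntLattice d))
      (fun j => g (j k + 1) - g (j k)) j
    = commutatorWeight (Equiv.addRight (1 : ℤ)) (fun n => g (n + 1) - g n) (j k) := by
  simp [commutatorWeight]

/-- A weight depending on one coordinate and on time. -/
noncomputable def slabWeight (g : ℤ → ℝ) (B : ℝ) (k : Fin d) (t : ℝ) (j : IntLattice d) : ℝ :=
  Real.exp (g (j k) - B / 2 * (t * (1 - t)))

theorem slabWeight_pos (g : ℤ → ℝ) (B : ℝ) (k : Fin d) (t : ℝ) (j : IntLattice d) :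
    0 < slabWeight g B k t j :=
  Real.exp_pos _

theorem norm_slabWeight (g : ℤ → ℝ) (B : ℝ) (k : Fin d) (t : ℝ) (j : IntLattice d) :
    ‖(slabWeight g B k t j : ℂ)‖ = slabWeight g B k t j := by
  rw [Complex.norm_real, Real.norm_of_nonneg (slabWeight_pos g B k t j).le]

theorem slabWeight_le (g : ℤ → ℝ) (B : ℝ) (k : Fin d) {t : ℝ} (ht : t ∈ Icc (0 : ℝ) 1)
    (j : IntLattice d) : slabWeight g B k t j ≤ Real.exp |B| * Real.exp (g (j k)) := by
  rw [slabWeight, ← Real.exp_add]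
  refine Real.exp_le_exp.2 ?_
  have h1 : 0 ≤ t * (1 - t) := mul_nonneg ht.1 (by linarith [ht.2])
  have h2 : t * (1 - t) ≤ 1 := by nlinarith [ht.1, ht.2]
  nlinarith [neg_abs_le B, abs_nonneg B]

theorem hasDerivAt_slabWeight (g : ℤ → ℝ) (B : ℝ) (k : Fin d) (t : ℝ) (j : IntLattice d) :
    HasDerivAt (fun s => (slabWeight g B k s j : ℂ))
      ((slabWeight g B k t j * (-(B / 2) + B * t) : ℝ) : ℂ) t := by
  have h1 : HasDerivAt (fun s => g (j k) - B / 2 * (s * (1 - s))) (-(B / 2) + B * t) t := by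
    refine ((((hasDerivAt_id t).fun_mul ((hasDerivAt_id t).const_sub 1)).const_mul
      (B / 2)).const_sub (g (j k))).congr_deriv ?_
    simp only [id]
    ring
  exact h1.exp.ofReal_comp

theorem absolutelyContinuousOnInterval_slabWeight (g : ℤ → ℝ) (B : ℝ) (k : Fin d)
    (j : IntLattice d) (a b : ℝ) :
    AbsolutelyContinuousOnInterval (fun s => (slabWeight g B k s j : ℂ)) a b := by
  have h : ContDiff ℝ 1 fun s => slabWeight g B k s j := by
    unfold slabWeight
    fun_prop
  exact (ContDiffOn.absolutelyContinuousOnInterval h.contDiffOn).clm_comp Complex.ofRealCLM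

theorem exp_mul_slabWeight_add (g : ℤ → ℝ) (B : ℝ) (k : Fin d) (t : ℝ) (j : IntLattice d) :
    Real.exp (-(g (j k + 1) - g (j k))) * slabWeight g B k t (j + Pi.single k 1)
      = slabWeight g B k t j := by
  rw [slabWeight, slabWeight, ← Real.exp_add, Pi.add_apply, Pi.single_eq_same]
  congr 1; ring

theorem exp_mul_slabWeight_sub (g : ℤ → ℝ) (B : ℝ) (k : Fin d) (t : ℝ) (j : IntLattice d) :
    Real.exp (g (j k) - g (j k - 1)) * slabWeight g B k t (j - Pi.single k 1)
      = slabWeight g B k t j := by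
  rw [slabWeight, slabWeight, ← Real.exp_add, Pi.sub_apply, Pi.single_eq_same]
  congr 1; ring

theorem slabWeight_add_of_ne (g : ℤ → ℝ) (B : ℝ) {k l : Fin d} (hkl : k ≠ l) (t : ℝ)
    (j : IntLattice d) : slabWeight g B k t (j + Pi.single l 1) = slabWeight g B k t j := by
  simp [slabWeight, hkl]

theorem slabWeight_sub_of_ne (g : ℤ → ℝ) (B : ℝ) {k l : Fin d} (hkl : k ≠ l) (t : ℝ)
    (j : IntLattice d) : slabWeight g B k t (j - Pi.single l 1) = slabWeight g B k t j := by
  simp [slabWeight, hkl]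

/-- Bounds on the neighbours of a site, the weight being evaluated at the site itself. -/
theorem exp_mul_norm_neighbor_le {g : ℤ → ℝ} {L K : ℝ} (hL : 0 ≤ L) (hK : 0 ≤ K) {k : Fin d}
    (hg : ∀ n : ℤ, |g (n + 1) - g n| ≤ L * (1 + |(n : ℝ)|)) {v : IntLattice d → ℂ}
    (hv : ∀ j, Real.exp (g (j k)) * ‖v j‖ ≤ K * Real.exp (-(2 * L + 1) * normOneLattice j))
    (j : IntLattice d) (l : Fin d) :
    Real.exp (g (j k)) * ‖v (j + Pi.single l 1)‖
        ≤ K * Real.exp (4 * L + 1) * Real.exp (-(L + 1) * normOneLattice j) ∧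
      Real.exp (g (j k)) * ‖v (j - Pi.single l 1)‖
        ≤ K * Real.exp (4 * L + 1) * Real.exp (-(L + 1) * normOneLattice j) := by
  constructor
  · refine exp_mul_norm_le_of_near hL hK (hv _) ?_ (normOneLattice_sub_one_le_add_single j l)
    rcases eq_or_ne k l with rfl | hkl
    · simpa using (abs_sub_le_of_growth hL hg (j k)).1
    · simp [hkl]; positivity
  · refine exp_mul_norm_le_of_near hL hK (hv _) ?_ (normOneLattice_sub_one_le_sub_single j l)
    rcases eq_or_ne k l with rfl | hkl
    · simpa using (abs_sub_le_of_growth hL hg (j k)).2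
    · simp [hkl]; positivity

theorem exp_mul_norm_generator_le {v : IntLattice d → ℂ} {j : IntLattice d} {z : ℂ}
    {C0 a y : ℝ} (hz : ‖z‖ ≤ C0) (h0 : Real.exp y * ‖v j‖ ≤ a)
    (h1 : ∀ l, Real.exp y * ‖v (j + Pi.single l 1)‖ ≤ a)
    (h2 : ∀ l, Real.exp y * ‖v (j - Pi.single l 1)‖ ≤ a) :
    Real.exp y * ‖Complex.I * (discreteLaplacian v j + z * v j)‖ ≤ (4 * d + C0) * a := by
  have hpos := Real.exp_pos y
  have h3 := norm_discreteLaplacian_le ((le_div_iff₀' hpos).2 h0)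
    (fun l => (le_div_iff₀' hpos).2 (h1 l)) (fun l => (le_div_iff₀' hpos).2 (h2 l))
  have h4 : ‖z * v j‖ ≤ C0 * (a / Real.exp y) := by
    rw [norm_mul]
    exact mul_le_mul hz ((le_div_iff₀' hpos).2 h0) (norm_nonneg _) ((norm_nonneg _).trans hz)
  rw [← le_div_iff₀' hpos, norm_mul, Complex.norm_I, one_mul]
  refine (norm_add_le _ _).trans ((add_le_add h3 h4).trans_eq ?_)
  ring

/-- The part of the conjugated generator not involving hopping in the `k`-th direction. -/
noncomputable def transversalPart (g : ℤ → ℝ) (B : ℝ) (k : Fin d) (t : ℝ)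
    (v z : IntLattice d → ℂ) (j : IntLattice d) : ℂ :=
  slabWeight g B k t j * (Complex.I * (discreteLaplacian v j + z j * v j)
    - Complex.I * (v (j + Pi.single k 1) + v (j - Pi.single k 1)))

/-- The weight is constant in directions other than `k`, so it passes through this hopping without
loss; hence a bound independent of `g` and `B`. -/
theorem norm_transversalPart_le (g : ℤ → ℝ) (B : ℝ) (k : Fin d) (t : ℝ)
    (v z : IntLattice d → ℂ) {C0 : ℝ} (hz : ∀ j, ‖z j‖ ≤ C0) (j : IntLattice d) :
    ‖transversalPart g B k t v z j‖ ≤ ∑ l ∈ Finset.univ.erase k,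
      (‖slabWeight g B k t (j + Pi.single l 1) * v (j + Pi.single l 1)‖
        + ‖slabWeight g B k t (j - Pi.single l 1) * v (j - Pi.single l 1)‖)
      + (2 * d + C0) * ‖slabWeight g B k t j * v j‖ := by
  have e1 : transversalPart g B k t v z j = Complex.I * (∑ l ∈ Finset.univ.erase k,
      (slabWeight g B k t (j + Pi.single l 1) * v (j + Pi.single l 1)
        + slabWeight g B k t (j - Pi.single l 1) * v (j - Pi.single l 1))
      + (z j - 2 * d) * (slabWeight g B k t j * v j)) := by
    have h1 : ∀ l ∈ Finset.univ.erase k,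
        (slabWeight g B k t (j + Pi.single l 1) * v (j + Pi.single l 1)
          + slabWeight g B k t (j - Pi.single l 1) * v (j - Pi.single l 1) : ℂ)
        = slabWeight g B k t j * (v (j + Pi.single l 1) + v (j - Pi.single l 1)) := by
      intro l hl
      have hkl : k ≠ l := (Finset.ne_of_mem_erase hl).symm
      rw [slabWeight_add_of_ne g B hkl, slabWeight_sub_of_ne g B hkl, mul_add]
    rw [Finset.sum_congr rfl h1, ← Finset.mul_sum, transversalPart]
    linear_combination (slabWeight g B k t j * Complex.I) * discreteLaplacian_sub_eq v j k
  rw [e1, norm_mul, Complex.norm_I, one_mul]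
  refine (norm_add_le _ _).trans (add_le_add ?_ ?_)
  · exact norm_sum_le_of_le _ fun l _ => norm_add_le _ _
  · rw [norm_mul]
    refine mul_le_mul_of_nonneg_right ((norm_sub_le _ _).trans ?_) (norm_nonneg _)
    have : ‖(2 * d : ℂ)‖ = 2 * d := by simp
    rw [this]
    linarith [hz j]

end

namespace IsSchrodingerSolution

variable {d : ℕ} {V : IntLattice d → ℝ → ℂ} {u : ℝ → EllTwo d}

/-- Conjugating a solution by a weight depending on one coordinate and on time. -/
theorem isConjugatedSolution (hu : IsSchrodingerSolution V u) {C0 : ℝ} (hC0 : 0 ≤ C0)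
    (hV : ∀ j, ∀ t ∈ Icc (0 : ℝ) 1, ‖V j t‖ ≤ C0) (k : Fin d) {g : ℤ → ℝ} {L K : ℝ}
    (hL : 0 ≤ L) (hK : 0 ≤ K) (hg : ∀ n : ℤ, |g (n + 1) - g n| ≤ L * (1 + |(n : ℝ)|))
    (hdec : ∀ t ∈ Icc (0 : ℝ) 1, ∀ j, Real.exp (g (j k)) * ‖u t j‖
      ≤ K * Real.exp (-(2 * L + 1) * normOneLattice j)) (B : ℝ) :
    ∃ m r w F, IsConjugatedSolution
      (Equiv.addRight (Pi.single k (1 : ℤ)) : Equiv.Perm (IntLattice d))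
      (fun j => g (j k + 1) - g (j k)) m r (-(B / 2)) B (8 * d + 2 * C0 + 1)
      (fun t j => slabWeight g B k t j * u t j) w F := by
  set K1 : ℝ := K * Real.exp (4 * L + 1) with hK1
  have hK10 : 0 ≤ K1 := by positivity
  -- Large enough for the solution (`1`), its derivative (`|B| + 4 * d + C0`) and the transversal
  -- part (`4 * d + C0 + 2`) to share one majorant.
  set N : ℝ := 4 * d + C0 + |B| + 3 with hN
  have hd0 : (0 : ℝ) ≤ d := Nat.cast_nonneg d
  have hN1 : 1 ≤ N := by linarith [abs_nonneg B]
  have ha0 : ∀ j : IntLattice d, 0 ≤ K1 * Real.exp (-(L + 1) * normOneLattice j) := fun j => by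
    positivity
  have hself : ∀ t ∈ Icc (0 : ℝ) 1, ∀ j, Real.exp (g (j k)) * ‖u t j‖
      ≤ K1 * Real.exp (-(L + 1) * normOneLattice j) := fun t ht j =>
    exp_mul_norm_le_of_near hL hK (v := u t) (hdec t ht j)
      (by rw [sub_self, abs_zero]; positivity) (by linarith)
  have hnb := fun t (ht : t ∈ Icc (0 : ℝ) 1) =>
    exp_mul_norm_neighbor_le hL hK hg (v := u t) (hdec t ht)
  have hGle : ∀ t ∈ Icc (0 : ℝ) 1, ∀ j, Real.exp (g (j k)) *
      ‖Complex.I * (discreteLaplacian (u t) j + V j t * u t j)‖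
      ≤ (4 * d + C0) * (K1 * Real.exp (-(L + 1) * normOneLattice j)) := fun t ht j =>
    exp_mul_norm_generator_le (hV j t ht) (hself t ht j) (fun l => (hnb t ht j l).1)
      (fun l => (hnb t ht j l).2)
  have hWle : ∀ t ∈ Icc (0 : ℝ) 1, ∀ j, ∀ x y : ℝ, 0 ≤ x → Real.exp (g (j k)) * x ≤ y →
      slabWeight g B k t j * x ≤ Real.exp |B| * y := by
    intro t ht j x y hx hy
    refine (mul_le_mul_of_nonneg_right (slabWeight_le g B k ht j) hx).trans ?_
    rw [mul_assoc]
    exact mul_le_mul_of_nonneg_left hy (Real.exp_pos _).le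
  have hvle : ∀ t ∈ Icc (0 : ℝ) 1, ∀ j, ‖slabWeight g B k t j * u t j‖
      ≤ Real.exp |B| * (K1 * Real.exp (-(L + 1) * normOneLattice j)) := by
    intro t ht j
    rw [norm_mul, norm_slabWeight]
    exact hWle t ht j _ _ (norm_nonneg _) (hself t ht j)
  have hmle : ∀ {x c : ℝ} (j : IntLattice d), c ≤ N →
      x ≤ c * (Real.exp |B| * (K1 * Real.exp (-(L + 1) * normOneLattice j))) →
      x ≤ (Real.exp |B| * N * K1) * Real.exp (-(L + 1) * normOneLattice j) := by
    intro x c j hc hx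
    refine hx.trans ((mul_le_mul_of_nonneg_right hc
      (mul_nonneg (Real.exp_pos _).le (ha0 j))).trans_eq ?_)
    ring
  have hdom := edgeDominated_lattice hL (by positivity : 0 ≤ Real.exp |B| * N * K1) k hg
  have hvm : ∀ t ∈ Icc (0 : ℝ) 1, ∀ j, ‖slabWeight g B k t j * u t j‖
      ≤ (Real.exp |B| * N * K1) * Real.exp (-(L + 1) * normOneLattice j) := fun t ht j =>
    hmle j hN1 (by rw [one_mul]; exact hvle t ht j)
  refine ⟨_, _, fun t j => ((-(B / 2) + B * t : ℝ) : ℂ) * (slabWeight g B k t j * u t j)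
      + slabWeight g B k t j * (Complex.I * (discreteLaplacian (u t) j + V j t * u t j)),
    fun t => transversalPart g B k t (u t) (fun j => V j t), hdom, fun j => ?_, hvm, ?_⟩
  · exact (absolutelyContinuousOnInterval_slabWeight g B k j 0 1).fun_smul
      (hu.absolutelyContinuous j)
  filter_upwards [hu.ae_equation] with t ht ht01
  have htI := Ioo_subset_Icc_self ht01
  have hlin : |(-(B / 2) + B * t)| ≤ |B| := by
    rw [show -(B / 2) + B * t = B * (t - 1 / 2) by ring, abs_mul]
    refine mul_le_of_le_one_right (abs_nonneg _) ?_
    rw [abs_le]; constructor <;> linarith [ht01.1, ht01.2]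
  refine ⟨fun j => ⟨?_, ?_, ?_, ?_⟩, ?_⟩
  · refine ((hasDerivAt_slabWeight g B k t j).fun_mul (ht ht01 j)).congr_deriv ?_
    push_cast
    ring
  · refine hmle (c := |B| + (4 * d + C0)) j (by linarith) ((norm_add_le _ _).trans ?_)
    rw [norm_mul, norm_mul (slabWeight g B k t j : ℂ) (Complex.I * _), norm_slabWeight,
      Complex.norm_real, Real.norm_eq_abs, add_mul]
    refine add_le_add (mul_le_mul hlin (hvle t htI j) (norm_nonneg _) (abs_nonneg _)) ?_
    rw [mul_left_comm]
    exact hWle t htI j _ _ (norm_nonneg _) (hGle t htI j)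
  · refine hmle (c := 4 * d + C0 + 2) j (by linarith [abs_nonneg B]) ?_
    rw [transversalPart, norm_mul, norm_slabWeight, mul_left_comm]
    refine hWle t htI j _ _ (norm_nonneg _) ?_
    have h1 : ‖Complex.I * (discreteLaplacian (u t) j + V j t * u t j)
        - Complex.I * (u t (j + Pi.single k 1) + u t (j - Pi.single k 1))‖
        ≤ ‖Complex.I * (discreteLaplacian (u t) j + V j t * u t j)‖
          + (‖u t (j + Pi.single k 1)‖ + ‖u t (j - Pi.single k 1)‖) := by
      refine (norm_sub_le _ _).trans (add_le_add le_rfl ?_)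
      rw [norm_mul, Complex.norm_I, one_mul]
      exact norm_add_le _ _
    refine (mul_le_mul_of_nonneg_left h1 (Real.exp_pos _).le).trans ?_
    have h2 := add_le_add (hGle t htI j) (add_le_add (hnb t htI j k).1 (hnb t htI j k).2)
    rw [← mul_add, ← mul_add] at h2
    refine h2.trans_eq ?_
    rw [← hK1]
    ring
  · have e1 := congrArg (fun x : ℝ => (x : ℂ)) (exp_mul_slabWeight_add g B k t j)
    have e2 := congrArg (fun x : ℝ => (x : ℂ)) (exp_mul_slabWeight_sub g B k t j)
    simp only [Complex.ofReal_mul] at e1 e2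
    simp only [Equiv.addRight_symm, Equiv.coe_addRight, Pi.add_apply, Pi.neg_apply,
      Pi.single_eq_same, ← sub_eq_add_neg, sub_add_cancel, transversalPart]
    linear_combination (-Complex.I * u t (j + Pi.single k 1)) * e1
      + (-Complex.I * u t (j - Pi.single k 1)) * e2
  · refine (tsum_norm_sq_transversal_le (c := 2 * d + C0) k (hdom.summable_norm_sq (hvm t htI))
      (norm_transversalPart_le g B k t (u t) _ fun j => hV j t htI)).trans ?_
    refine mul_le_mul_of_nonneg_right ?_ (tsum_nonneg fun _ => sq_nonneg _)
    -- The claim is `8 * d ^ 2 + 2 * (2 * d + C0) ^ 2 ≤ (8 * d + 2 * C0 + 1) ^ 2`.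
    nlinarith [mul_nonneg hd0 hC0]

/-- Weighted estimate for a solution in terms of its end point values. -/
theorem exp_mul_norm_sq_le (hu : IsSchrodingerSolution V u) {C0 : ℝ} (hC0 : 0 ≤ C0)
    (hV : ∀ j, ∀ t ∈ Icc (0 : ℝ) 1, ‖V j t‖ ≤ C0) (k : Fin d) {g : ℤ → ℝ} {L K : ℝ}
    (hL : 0 ≤ L) (hK : 0 ≤ K) (hg : ∀ n : ℤ, |g (n + 1) - g n| ≤ L * (1 + |(n : ℝ)|))
    (hdec : ∀ t ∈ Icc (0 : ℝ) 1, ∀ j, Real.exp (g (j k)) * ‖u t j‖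
      ≤ K * Real.exp (-(2 * L + 1) * normOneLattice j)) {B X lam : ℝ}
    (hq : ∀ n : ℤ, (8 * d + 2 * C0 + 1) ^ 2 / 2
      ≤ B + commutatorWeight (Equiv.addRight (1 : ℤ)) (fun n => g (n + 1) - g n) n)
    (hlam : 0 ≤ lam) (hX : ∀ n : ℤ, 2 * g n ≤ 2 * lam * (n : ℝ) ^ 2 + X)
    (hdecay : Summable fun j : IntLattice d =>
      Real.exp (2 * lam * normSqLattice j) * (‖u 0 j‖ ^ 2 + ‖u 1 j‖ ^ 2))
    {t : ℝ} (ht : t ∈ Icc (0 : ℝ) 1) (j : IntLattice d) :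
    Real.exp (2 * g (j k) - B * (t * (1 - t))) * ‖u t j‖ ^ 2
      ≤ Real.exp (2 * (8 * d + 2 * C0 + 1)) * (Real.exp X * ∑' j : IntLattice d,
        Real.exp (2 * lam * normSqLattice j) * (‖u 0 j‖ ^ 2 + ‖u 1 j‖ ^ 2)) := by
  obtain ⟨m, r, w, F, h⟩ := hu.isConjugatedSolution hC0 hV k hL hK hg hdec B
  have key := h.tsum_norm_sq_le (by positivity)
    (fun j => by rw [commutatorWeight_lattice]; exact hq (j k)) ht
  have hn : ∀ s j, ‖(slabWeight g B k s j : ℂ) * u s j‖ ^ 2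
      = Real.exp (2 * g (j k) - B * (s * (1 - s))) * ‖u s j‖ ^ 2 := by
    intro s j
    rw [norm_mul, norm_slabWeight, slabWeight, mul_pow, ← Real.exp_nat_mul]
    congr 2
    push_cast; ring
  have hs : ∀ s ∈ Icc (0 : ℝ) 1, Summable fun j : IntLattice d =>
      Real.exp (2 * g (j k) - B * (s * (1 - s))) * ‖u s j‖ ^ 2 := fun s hs =>
    (h.dominated.summable_norm_sq (h.norm_le s hs)).congr fun j => hn s j
  simp only [hn] at key
  have h0 := hs 0 (by simp)
  have h1 := hs 1 (by simp)
  refine ((hs t ht).le_tsum j fun _ _ => by positivity).trans (key.trans ?_)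
  refine mul_le_mul_of_nonneg_left ?_ (Real.exp_pos _).le
  rw [← h0.tsum_add h1, ← tsum_mul_left]
  refine (h0.add h1).tsum_le_tsum (fun j => ?_) (hdecay.mul_left _)
  have hk : (j k : ℝ) ^ 2 ≤ normSqLattice j :=
    Finset.single_le_sum (f := fun k => (j k : ℝ) ^ 2) (fun _ _ => sq_nonneg _)
      (Finset.mem_univ k)
  have he : Real.exp (2 * g (j k)) ≤ Real.exp X * Real.exp (2 * lam * normSqLattice j) := by
    -- At `s = 0` and `s = 1` the factor `s * (1 - s)` vanishes, so only the spatial weight has to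
    -- be compared with the Gaussian.
    rw [← Real.exp_add]
    refine Real.exp_le_exp.2 ((hX _).trans ?_)
    nlinarith
  rw [← mul_assoc]
  simp only [zero_mul, sub_self, mul_zero, sub_zero]
  rw [← mul_add]
  rw [← mul_assoc]
  exact mul_le_mul_of_nonneg_right he (by positivity)

end IsSchrodingerSolution

/-! ### The weights -/

theorem commutatorWeight_linear (β : ℝ) (n : ℤ) :
    commutatorWeight (Equiv.addRight (1 : ℤ))
      (fun n : ℤ => β * ((n + 1 : ℤ) : ℝ) - β * (n : ℝ)) n = 0 := by
  have h : ∀ n : ℤ, β * ((n + 1 : ℤ) : ℝ) - β * (n : ℝ) = β := fun n => by push_cast; ring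
  simp only [commutatorWeight, h]
  simp

/-- The weight `β |n| + n² / 2`. -/
noncomputable def peakedWeight (β : ℝ) (n : ℤ) : ℝ := β * |(n : ℝ)| + (n : ℝ) ^ 2 / 2

section

variable {β : ℝ}

theorem peakedWeight_increment_of_nonneg {n : ℤ} (hn : 0 ≤ n) :
    peakedWeight β (n + 1) - peakedWeight β n = β + n + 1 / 2 := by
  have h : (0 : ℝ) ≤ n := by exact_mod_cast hn
  rw [peakedWeight, peakedWeight]
  push_cast
  rw [abs_of_nonneg h, abs_of_nonneg (by linarith)]
  ring

theorem peakedWeight_increment_of_neg {n : ℤ} (hn : n < 0) :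
    peakedWeight β (n + 1) - peakedWeight β n = -β + n + 1 / 2 := by
  have h : (n : ℝ) + 1 ≤ 0 := by exact_mod_cast hn
  rw [peakedWeight, peakedWeight]
  push_cast
  rw [abs_of_nonpos h, abs_of_nonpos (by linarith)]
  ring

theorem abs_peakedWeight_increment_le (hβ : 0 ≤ β) (n : ℤ) :
    |peakedWeight β (n + 1) - peakedWeight β n| ≤ (β + 1) * (1 + |(n : ℝ)|) := by
  have h0 := mul_nonneg hβ (abs_nonneg (n : ℝ))
  rcases le_or_gt 0 n with hn | hn
  · rw [peakedWeight_increment_of_nonneg hn, abs_le]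
    constructor <;> nlinarith [le_abs_self (n : ℝ), neg_abs_le (n : ℝ)]
  · rw [peakedWeight_increment_of_neg hn, abs_le]
    constructor <;> nlinarith [le_abs_self (n : ℝ), neg_abs_le (n : ℝ)]

/-- The second increment is `1` except at `n = -1`, where the corner of `β * |n|` raises it to `2 *
β + 1`. -/
theorem abs_sinh_peakedWeight_second_increment_le (hβ : 0 ≤ β) (n : ℤ) :
    |Real.sinh ((peakedWeight β (n + 1 + 1) - peakedWeight β (n + 1))
      - (peakedWeight β (n + 1) - peakedWeight β n))| ≤ Real.exp (2 * β + 1) / 2 := by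
  have hb : ∀ x : ℝ, 0 ≤ x → x ≤ 2 * β + 1 → |Real.sinh x| ≤ Real.exp (2 * β + 1) / 2 := by
    intro x hx0 hx
    rw [Real.abs_sinh, abs_of_nonneg hx0, Real.sinh_eq]
    linarith [Real.exp_pos (-x), Real.exp_le_exp.2 hx]
  rcases lt_trichotomy n (-1) with hn | rfl | hn
  · rw [peakedWeight_increment_of_neg (by lia : n < 0),
      peakedWeight_increment_of_neg (by lia : n + 1 < 0)]
    push_cast
    exact hb _ (by linarith) (by linarith)
  · rw [peakedWeight_increment_of_neg (by lia : (-1 : ℤ) < 0),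
      peakedWeight_increment_of_nonneg (by lia : (0 : ℤ) ≤ -1 + 1)]
    push_cast
    exact hb _ (by linarith) (by linarith)
  · rw [peakedWeight_increment_of_nonneg (by lia : 0 ≤ n),
      peakedWeight_increment_of_nonneg (by lia : 0 ≤ n + 1)]
    push_cast
    exact hb _ (by linarith) (by linarith)

theorem three_mul_exp_le_sinh_sub_sinh (p : ℝ) :
    3 * Real.exp p ≤ Real.sinh (p + 2) - Real.sinh p := by
  rw [Real.sinh_eq, Real.sinh_eq, Real.exp_add]
  have h1 : (7 : ℝ) ≤ Real.exp 2 := by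
    have : Real.exp 2 = Real.exp 1 * Real.exp 1 := by rw [← Real.exp_add]; norm_num
    nlinarith [Real.exp_one_gt_d9]
  have h2 : Real.exp (-(p + 2)) ≤ Real.exp (-p) := Real.exp_le_exp.2 (by linarith)
  nlinarith [Real.exp_pos p]

/-- The commutator weight of the peaked weight is uniformly large. -/
theorem exp_sub_four_le_commutatorWeight (hβ : 0 ≤ β) (n : ℤ) :
    Real.exp (2 * β) - 4 ≤ commutatorWeight (Equiv.addRight (1 : ℤ))
      (fun n => peakedWeight β (n + 1) - peakedWeight β n) n := by
  have b1 := abs_sinh_peakedWeight_second_increment_le hβ n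
  have b2 := abs_sinh_peakedWeight_second_increment_le hβ (n - 1 - 1)
  rw [sub_add_cancel, sub_add_cancel] at b2
  simp only [commutatorWeight, Equiv.coe_addRight, Equiv.addRight_symm, ← sub_eq_add_neg,
    sub_add_cancel]
  have he : Real.exp (2 * β + 1) = Real.exp (2 * β) * Real.exp 1 := Real.exp_add _ _
  have e1 := Real.exp_one_gt_d9
  have e2 := Real.exp_one_lt_d9
  have hx := Real.one_le_exp (by linarith : 0 ≤ 2 * β)
  -- Away from `0` the curvature of `n ^ 2 / 2` gives at least `3 * exp (2 * β + 1)`, against two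
  -- errors of total at most `exp (2 * β + 1)`. At `0` the corner gives `2 * sinh (2 * β + 1)`, and
  -- both errors are only `sinh 1`.
  rcases lt_trichotomy n 0 with hn | rfl | hn
  · have t1 := peakedWeight_increment_of_neg (β := β) hn
    have t2 := peakedWeight_increment_of_neg (β := β) (by lia : n - 1 < 0)
    rw [sub_add_cancel] at t2
    have hn' : (n : ℝ) + 1 ≤ 0 := by exact_mod_cast hn
    have key := three_mul_exp_le_sinh_sub_sinh (-(2 * (-β + n + 1 / 2)))
    rw [show -(2 * (-β + n + 1 / 2)) + 2 = -(2 * (-β + (n - 1 : ℤ) + 1 / 2)) by push_cast; ring,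
      Real.sinh_neg, Real.sinh_neg, ← t1, ← t2] at key
    have hm : Real.exp (2 * β + 1) ≤ Real.exp (-(2 * (-β + n + 1 / 2))) :=
      Real.exp_le_exp.2 (by linarith)
    rw [← t1] at hm
    nlinarith
  · have t1 := peakedWeight_increment_of_nonneg (β := β) le_rfl
    have t2 := peakedWeight_increment_of_neg (β := β) (by lia : (0 : ℤ) - 1 < 0)
    rw [sub_add_cancel] at t2
    have c1 : peakedWeight β (0 + 1 + 1) - peakedWeight β (0 + 1)
        - (peakedWeight β (0 + 1) - peakedWeight β 0) = 1 := by
      rw [t1, peakedWeight_increment_of_nonneg (by lia : (0 : ℤ) ≤ 0 + 1)]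
      push_cast; ring
    have c2 : peakedWeight β 0 - peakedWeight β (0 - 1)
        - (peakedWeight β (0 - 1) - peakedWeight β (0 - 1 - 1)) = 1 := by
      have t3 := peakedWeight_increment_of_neg (β := β) (by lia : (0 : ℤ) - 1 - 1 < 0)
      rw [sub_add_cancel] at t3
      rw [t2, t3]
      push_cast; ring
    rw [c1, c2, t1, t2]
    have s1 : 2 * (β + ((0 : ℤ) : ℝ) + 1 / 2) = 2 * β + 1 := by push_cast; ring
    have s2 : 2 * (-β + ((0 - 1 : ℤ) : ℝ) + 1 / 2) = -(2 * β + 1) := by push_cast; ring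
    rw [s1, s2, Real.sinh_neg, Real.sinh_eq, abs_of_pos (Real.sinh_pos_iff.2 one_pos),
      Real.sinh_eq]
    have h1 : Real.exp (-(2 * β + 1)) ≤ 1 := Real.exp_le_one_iff.2 (by linarith)
    have h2 := Real.exp_pos (-1)
    nlinarith
  · have t1 := peakedWeight_increment_of_nonneg (β := β) hn.le
    have t2 := peakedWeight_increment_of_nonneg (β := β) (by lia : 0 ≤ n - 1)
    rw [sub_add_cancel] at t2
    have hn' : (1 : ℝ) ≤ n := by exact_mod_cast hn
    have key := three_mul_exp_le_sinh_sub_sinh (2 * (β + (n - 1 : ℤ) + 1 / 2))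
    rw [show 2 * (β + (n - 1 : ℤ) + 1 / 2) + 2 = 2 * (β + (n : ℝ) + 1 / 2) by push_cast; ring,
      ← t1, ← t2] at key
    have hm : Real.exp (2 * β + 1) ≤ Real.exp (2 * (β + (n - 1 : ℤ) + 1 / 2)) := by
      refine Real.exp_le_exp.2 ?_
      push_cast
      linarith
    rw [← t2] at hm
    nlinarith

end

theorem two_mul_sub_mul_sq_le {a : ℝ} (ha : 0 < a) (b x : ℝ) :
    2 * b * x ≤ a * x ^ 2 + b ^ 2 / a := by
  have h : a * x ^ 2 + b ^ 2 / a - 2 * b * x = a * (x - b / a) ^ 2 := by field_simp; ring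
  have : 0 ≤ a * (x - b / a) ^ 2 := by positivity
  linarith

/-! ### Decay at intermediate times and vanishing -/

namespace IsSchrodingerSolution

variable {d : ℕ} {V : IntLattice d → ℝ → ℂ} {u : ℝ → EllTwo d} {C0 lam : ℝ}

theorem exists_exponential_decay (hu : IsSchrodingerSolution V u) (hC0 : 0 ≤ C0)
    (hV : ∀ j, ∀ t ∈ Icc (0 : ℝ) 1, ‖V j t‖ ≤ C0) (hlam : 0 < lam)
    (hdecay : Summable fun j : IntLattice d =>
      Real.exp (2 * lam * normSqLattice j) * (‖u 0 j‖ ^ 2 + ‖u 1 j‖ ^ 2))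
    {b : ℝ} (hb : 0 ≤ b) : ∃ K : ℝ, 0 ≤ K ∧ ∀ t ∈ Icc (0 : ℝ) 1, ∀ j,
      ‖u t j‖ ≤ K * Real.exp (-b * normOneLattice j) := by
  set S := ∑' j : IntLattice d,
    Real.exp (2 * lam * normSqLattice j) * (‖u 0 j‖ ^ 2 + ‖u 1 j‖ ^ 2) with hS
  set K := Real.sqrt S * Real.exp (d * (b ^ 2 / (4 * lam))) with hK
  have hinit : ∀ j, ‖u 0 j‖ ≤ K * Real.exp (-b * normOneLattice j) := by
    intro j
    have h1 : Real.exp (2 * lam * normSqLattice j) * (‖u 0 j‖ ^ 2 + ‖u 1 j‖ ^ 2) ≤ S :=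
      hdecay.le_tsum j fun _ _ => by positivity
    have h2 : (Real.exp (lam * normSqLattice j) * ‖u 0 j‖) ^ 2 ≤ S := by
      rw [mul_pow, ← Real.exp_nat_mul]
      refine le_trans ?_ h1
      push_cast
      rw [← mul_assoc]
      exact mul_le_mul_of_nonneg_left (by linarith [sq_nonneg ‖u 1 j‖]) (Real.exp_pos _).le
    have h3 := Real.le_sqrt_of_sq_le h2
    have h4 := mul_normOneLattice_le hlam b j
    calc ‖u 0 j‖ = Real.exp (-(lam * normSqLattice j))
          * (Real.exp (lam * normSqLattice j) * ‖u 0 j‖) := by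
          rw [← mul_assoc, ← Real.exp_add, neg_add_cancel, Real.exp_zero, one_mul]
      _ ≤ Real.exp (d * (b ^ 2 / (4 * lam)) + -b * normOneLattice j) * Real.sqrt S :=
          mul_le_mul (Real.exp_le_exp.2 (by linarith)) h3 (by positivity) (Real.exp_pos _).le
      _ = _ := by rw [Real.exp_add, hK]; ring
  refine ⟨K * Real.exp (d * (2 + 2 * Real.exp b) + C0), by positivity, fun t ht j => ?_⟩
  refine (hu.norm_le_of_initial_decay hC0 hV (by positivity) hb hinit ht j).trans ?_
  rw [mul_right_comm K]
  have h5 : 0 ≤ d * (2 + 2 * Real.exp b) + C0 := by positivity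
  refine mul_le_mul_of_nonneg_right (mul_le_mul_of_nonneg_left (Real.exp_le_exp.2 ?_)
    (by positivity)) (Real.exp_pos _).le
  exact mul_le_of_le_one_right h5 ht.2

/-- Linear weights have zero commutator, so `B = M ^ 2 / 2` works for every slope with the same
constants. Choosing the optimal slope for each site, as in a Legendre transform, recovers the full
Gaussian rate. -/
theorem exists_gaussian_decay (hu : IsSchrodingerSolution V u) (hC0 : 0 ≤ C0)
    (hV : ∀ j, ∀ t ∈ Icc (0 : ℝ) 1, ‖V j t‖ ≤ C0) (hlam : 0 < lam)
    (hdecay : Summable fun j : IntLattice d =>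
      Real.exp (2 * lam * normSqLattice j) * (‖u 0 j‖ ^ 2 + ‖u 1 j‖ ^ 2)) (k : Fin d) :
    ∃ K : ℝ, 0 ≤ K ∧ ∀ t ∈ Icc (0 : ℝ) 1, ∀ j,
      ‖u t j‖ ≤ K * Real.exp (-lam * (j k : ℝ) ^ 2) := by
  set S := ∑' j : IntLattice d,
    Real.exp (2 * lam * normSqLattice j) * (‖u 0 j‖ ^ 2 + ‖u 1 j‖ ^ 2) with hS
  set M : ℝ := 8 * d + 2 * C0 + 1 with hM
  refine ⟨Real.sqrt (Real.exp (M ^ 2 / 2) * (Real.exp (2 * M) * S)), by positivity,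
    fun t ht j => ?_⟩
  -- The weight gives `exp (4 * lam * (j k) ^ 2)` at the site and the endpoints cost `exp (2 * lam *
  -- (j k) ^ 2)`; the quotient is the claimed decay of `‖u t j‖ ^ 2`.
  set β : ℝ := 2 * lam * j k with hβ
  obtain ⟨K, hK, hdec⟩ := hu.exists_exponential_decay hC0 hV hlam hdecay
    (b := |β| + (2 * |β| + 1)) (by positivity)
  have key := hu.exp_mul_norm_sq_le hC0 hV k (g := fun n => β * n) (L := |β|) (K := K)
    (B := M ^ 2 / 2) (X := 2 * lam * (j k : ℝ) ^ 2) (lam := lam) (abs_nonneg β) hK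
    (fun n => by
      rw [show β * ((n + 1 : ℤ) : ℝ) - β * n = β by push_cast; ring]
      nlinarith [mul_nonneg (abs_nonneg β) (abs_nonneg (n : ℝ))])
    (fun s hs l => by
      have h1 : β * (l k : ℝ) ≤ |β| * normOneLattice l := by
        refine (le_abs_self _).trans ?_
        rw [abs_mul]
        exact mul_le_mul_of_nonneg_left (abs_coord_le_normOneLattice l k) (abs_nonneg β)
      calc _ ≤ Real.exp (|β| * normOneLattice l)
            * (K * Real.exp (-(|β| + (2 * |β| + 1)) * normOneLattice l)) :=
            mul_le_mul (Real.exp_le_exp.2 h1) (hdec s hs l) (norm_nonneg _) (Real.exp_pos _).le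
        _ = _ := by
            rw [mul_left_comm, ← Real.exp_add]; ring_nf)
    (fun n => by rw [commutatorWeight_linear, add_zero]) hlam.le
    (fun n => by
      rw [hβ]
      nlinarith [mul_nonneg hlam.le (sq_nonneg ((n : ℝ) - j k))])
    hdecay ht j
  rw [← hS, ← hM] at key
  have hτ : t * (1 - t) ≤ 1 := by nlinarith [ht.1, ht.2]
  have h2 : (Real.exp (lam * (j k : ℝ) ^ 2) * ‖u t j‖) ^ 2
      ≤ Real.exp (M ^ 2 / 2) * (Real.exp (2 * M) * S) := by
    have e1 : Real.exp (2 * (β * (j k : ℝ)) - M ^ 2 / 2 * (t * (1 - t)))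
        = Real.exp (2 * lam * (j k : ℝ) ^ 2) * Real.exp (2 * lam * (j k : ℝ) ^ 2
          - M ^ 2 / 2 * (t * (1 - t))) := by
      rw [← Real.exp_add, hβ]; congr 1; ring
    rw [e1, mul_assoc, mul_left_comm (Real.exp (2 * M)),
      mul_le_mul_iff_of_pos_left (Real.exp_pos _)] at key
    refine le_trans ?_ (mul_le_mul_of_nonneg_left key (Real.exp_pos (M ^ 2 / 2)).le)
    rw [mul_pow, ← Real.exp_nat_mul, ← mul_assoc (Real.exp (M ^ 2 / 2)), ← Real.exp_add]
    refine mul_le_mul_of_nonneg_right (Real.exp_le_exp.2 ?_) (sq_nonneg _)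
    push_cast
    nlinarith [sq_nonneg M]
  have h3 := Real.le_sqrt_of_sq_le h2
  calc ‖u t j‖ = Real.exp (-lam * (j k : ℝ) ^ 2)
        * (Real.exp (lam * (j k : ℝ) ^ 2) * ‖u t j‖) := by
        rw [← mul_assoc, ← Real.exp_add, neg_mul, neg_add_cancel, Real.exp_zero, one_mul]
    _ ≤ _ := by
        rw [mul_comm]
        exact mul_le_mul_of_nonneg_right h3 (Real.exp_pos _).le

/-- Decay of a solution against the peaked weight, uniformly in time. -/
theorem exists_peaked_decay (hu : IsSchrodingerSolution V u) (hC0 : 0 ≤ C0)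
    (hV : ∀ j, ∀ t ∈ Icc (0 : ℝ) 1, ‖V j t‖ ≤ C0) (hlam : 1 / 2 < lam)
    (hdecay : Summable fun j : IntLattice d =>
      Real.exp (2 * lam * normSqLattice j) * (‖u 0 j‖ ^ 2 + ‖u 1 j‖ ^ 2)) (k : Fin d)
    {β b : ℝ} (hβ : 0 ≤ β) (hb : 0 ≤ b) :
    ∃ K : ℝ, 0 ≤ K ∧ ∀ t ∈ Icc (0 : ℝ) 1, ∀ j,
      Real.exp (peakedWeight β (j k)) * ‖u t j‖ ≤ K * Real.exp (-b * normOneLattice j) := by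
  have hlam0 : 0 < lam := by linarith
  set ε : ℝ := lam - 1 / 2 with hε
  have hε0 : 0 < ε := by linarith
  obtain ⟨K1, hK1, h1⟩ := hu.exists_gaussian_decay hC0 hV hlam0 hdecay k
  obtain ⟨K2, hK2, h2⟩ := hu.exists_exponential_decay hC0 hV hlam0 hdecay
    (b := (β + b) * (1 + 1 / (2 * ε))) (by positivity)
  refine ⟨K1 + K2, by positivity, fun t ht j => ?_⟩
  set x := |(j k : ℝ)| with hx
  have hx0 : 0 ≤ x := abs_nonneg _
  have hxν : x ≤ normOneLattice j := abs_coord_le_normOneLattice j k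
  have hg : peakedWeight β (j k) = β * x + x ^ 2 / 2 := by rw [peakedWeight, hx, sq_abs]
  have hsq : (j k : ℝ) ^ 2 = x ^ 2 := by rw [hx, sq_abs]
  have hfin : ∀ {K y : ℝ}, 0 ≤ K → K ≤ K1 + K2 → ‖u t j‖ ≤ K * Real.exp y →
      peakedWeight β (j k) + y ≤ -b * normOneLattice j →
      Real.exp (peakedWeight β (j k)) * ‖u t j‖
        ≤ (K1 + K2) * Real.exp (-b * normOneLattice j) := by
    intro K y hK hKK hle hy
    calc _ ≤ Real.exp (peakedWeight β (j k)) * (K * Real.exp y) :=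
          mul_le_mul_of_nonneg_left hle (Real.exp_pos _).le
      _ = K * Real.exp (peakedWeight β (j k) + y) := by rw [mul_left_comm, ← Real.exp_add]
      _ ≤ _ := mul_le_mul hKK (Real.exp_le_exp.2 hy) (Real.exp_pos _).le (by linarith)
  -- Where the coordinate `k` is large relative to the whole site, the spare `ε * x ^ 2` of the
  -- Gaussian bound pays for everything; elsewhere `x ^ 2 / 2` is at most linear in the `ℓ¹` norm,
  -- and exponential decay suffices.
  rcases le_total ((β + b) * normOneLattice j) (ε * x ^ 2) with h | h
  · refine hfin hK1 (by linarith) (h1 t ht j) ?_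
    rw [hg, hsq]
    nlinarith [mul_le_mul_of_nonneg_left hxν hβ]
  · refine hfin hK2 (by linarith) (h2 t ht j) ?_
    rw [hg]
    have h3 : x ^ 2 / 2 ≤ (β + b) * (1 / (2 * ε)) * normOneLattice j := by
      have : x ^ 2 ≤ (β + b) * normOneLattice j / ε := (le_div_iff₀' hε0).2 h
      calc x ^ 2 / 2 ≤ ((β + b) * normOneLattice j / ε) / 2 := by linarith
        _ = _ := by field_simp
    nlinarith [mul_le_mul_of_nonneg_left hxν hβ]

theorem eq_zero_of_mem_Ioo (hu : IsSchrodingerSolution V u) (hC0 : 0 ≤ C0)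
    (hV : ∀ j, ∀ t ∈ Icc (0 : ℝ) 1, ‖V j t‖ ≤ C0) (hlam : 1 / 2 < lam)
    (hdecay : Summable fun j : IntLattice d =>
      Real.exp (2 * lam * normSqLattice j) * (‖u 0 j‖ ^ 2 + ‖u 1 j‖ ^ 2)) (k : Fin d)
    {t : ℝ} (ht : t ∈ Ioo (0 : ℝ) 1) (j : IntLattice d) : u t j = 0 := by
  set S := ∑' j : IntLattice d,
    Real.exp (2 * lam * normSqLattice j) * (‖u 0 j‖ ^ 2 + ‖u 1 j‖ ^ 2) with hS
  have hS0 : 0 ≤ S := tsum_nonneg fun _ => by positivity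
  set M : ℝ := 8 * d + 2 * C0 + 1 with hM
  set τ : ℝ := t * (1 - t) with hτ
  have hτ0 : 0 < τ := mul_pos ht.1 (by linarith [ht.2])
  set a : ℝ := 2 * lam - 1 with ha
  have ha0 : 0 < a := by linarith
  have hbound : ∀ β : ℝ, 0 ≤ β → ‖u t j‖ ^ 2 ≤ Real.exp (2 * M) * S *
      Real.exp (β ^ 2 / a + (M ^ 2 / 2 + 4 - Real.exp (2 * β)) * τ) := by
    intro β hβ
    obtain ⟨K, hK, hdec⟩ := hu.exists_peaked_decay hC0 hV hlam hdecay k hβ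
      (b := 2 * (β + 1) + 1) (by positivity)
    -- `B` is the smallest value the commutator bound permits, and `X` is the maximum of `2 * β * x
    -- - a * x ^ 2`.
    have key := hu.exp_mul_norm_sq_le hC0 hV k (g := peakedWeight β) (L := β + 1) (K := K)
      (B := M ^ 2 / 2 + 4 - Real.exp (2 * β)) (X := β ^ 2 / a) (lam := lam) (by linarith) hK
      (abs_peakedWeight_increment_le hβ) hdec
      (fun n => by linarith [exp_sub_four_le_commutatorWeight hβ n]) (by linarith)
      (fun n => by
        rw [peakedWeight, ← sq_abs (n : ℝ)]
        have := two_mul_sub_mul_sq_le ha0 β |(n : ℝ)|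
        rw [ha] at this ⊢
        linarith)
      hdecay (Ioo_subset_Icc_self ht) j
    rw [← hS, ← hM, ← hτ] at key
    have hg : 0 ≤ peakedWeight β (j k) := by
      rw [peakedWeight]; positivity
    set B := M ^ 2 / 2 + 4 - Real.exp (2 * β)
    have h1 : Real.exp (-(B * τ)) * ‖u t j‖ ^ 2
        ≤ Real.exp (2 * M) * (Real.exp (β ^ 2 / a) * S) := by
      refine le_trans (mul_le_mul_of_nonneg_right (Real.exp_le_exp.2 ?_) (sq_nonneg _)) key
      linarith
    calc ‖u t j‖ ^ 2 = Real.exp (B * τ) * (Real.exp (-(B * τ)) * ‖u t j‖ ^ 2) := by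
          rw [← mul_assoc, ← Real.exp_add, add_neg_cancel, Real.exp_zero, one_mul]
      _ ≤ Real.exp (B * τ) * (Real.exp (2 * M) * (Real.exp (β ^ 2 / a) * S)) :=
          mul_le_mul_of_nonneg_left h1 (Real.exp_pos _).le
      _ = _ := by rw [Real.exp_add]; ring
  -- The endpoint cost is quadratic in `β`, whereas the interior gain `exp (2 * β) * τ` is
  -- exponential.
  have hlim : Filter.Tendsto (fun β : ℝ =>
      β ^ 2 / a + (M ^ 2 / 2 + 4 - Real.exp (2 * β)) * τ) Filter.atTop Filter.atBot := by
    have h1 : Filter.Tendsto (fun β : ℝ => τ * β ^ 2 - (M ^ 2 / 2 + 4) * τ) Filter.atTop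
        Filter.atTop := by
      refine Filter.tendsto_atTop_add_const_right _ _ ?_
      exact (Filter.tendsto_pow_atTop two_ne_zero).const_mul_atTop hτ0
    have h2 := Filter.tendsto_neg_atTop_atBot.comp h1
    refine Filter.tendsto_atBot_mono' _ ?_ h2
    filter_upwards [(Real.tendsto_exp_div_pow_atTop 2).eventually_ge_atTop
      (1 / (a * τ) + 1), Filter.eventually_gt_atTop 0] with β hβ hβ0
    have h3 : (1 / (a * τ) + 1) * β ^ 2 ≤ Real.exp β := (le_div_iff₀ (by positivity)).1 hβ
    have h4 : Real.exp β ≤ Real.exp (2 * β) := Real.exp_le_exp.2 (by linarith)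
    have h5 : (1 / (a * τ) + 1) * β ^ 2 * τ ≤ Real.exp (2 * β) * τ :=
      mul_le_mul_of_nonneg_right (h3.trans h4) hτ0.le
    have h6 : (1 / (a * τ) + 1) * β ^ 2 * τ = β ^ 2 / a + τ * β ^ 2 := by field_simp
    simp only [Function.comp_apply]
    linarith
  have hlim2 := (Real.tendsto_exp_atBot.comp hlim).const_mul (Real.exp (2 * M) * S)
  rw [mul_zero] at hlim2
  have h0 : ‖u t j‖ ^ 2 ≤ 0 := by
    refine ge_of_tendsto hlim2 ?_
    filter_upwards [Filter.eventually_ge_atTop 0] with β hβ using hbound β hβ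
  exact norm_eq_zero.1 (pow_eq_zero_iff two_ne_zero |>.1 (le_antisymm h0 (sq_nonneg _)))

end IsSchrodingerSolution

theorem theorem4p1 (d : ℕ) (hd : 1 ≤ d)
    (V : IntLattice d → ℝ → ℂ) (hV : IsBoundedPotential V)
    (u : ℝ → EllTwo d) (hu : IsSchrodingerSolution V u)
    (lam : ℝ) (hlam : 1 / 2 < lam)
    (hdecay : Summable fun j : IntLattice d =>
      Real.exp (2 * lam * normSqLattice j) * (‖u 0 j‖ ^ 2 + ‖u 1 j‖ ^ 2)) :
    ∀ t ∈ Icc (0 : ℝ) 1, u t = 0 := by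
  obtain ⟨C, hC⟩ := hV
  have hC0 : 0 ≤ C := (norm_nonneg _).trans (hC 0 0 (by simp))
  -- One direction is enough; `1 ≤ d` provides the coordinate `0`.
  have hint : Ioo (0 : ℝ) 1 ⊆ u ⁻¹' {0} := fun t ht =>
    lp.ext (funext fun j => hu.eq_zero_of_mem_Ioo hC0 hC hlam hdecay ⟨0, hd⟩ ht j)
  have hcl : closure (Ioo (0 : ℝ) 1) = Icc 0 1 := closure_Ioo (by norm_num)
  intro t ht
  have h := (hu.continuousOn t ht).mono_left (nhdsWithin_mono t Ioo_subset_Icc_self)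
  have hne : (nhdsWithin t (Ioo (0 : ℝ) 1)).NeBot :=
    mem_closure_iff_nhdsWithin_neBot.1 (hcl ▸ ht)
  refine tendsto_nhds_unique h ((tendsto_const_nhds (x := (0 : EllTwo d))).congr' ?_)
  filter_upwards [self_mem_nhdsWithin] with s hs using (hint hs).symm
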